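/- For each integer $n\ge 1$ let $J_1,J_2,J_3:\mathbb C^n\to\mathbb C^n$ be the self-adjoint generators of an $n$-dimensional unitary irreducible representation of $SU(2)$, normalised by $[J_1,J_2]=iJ_3$, $[J_2,J_3]=iJ_1$, $[J_3,J_1]=iJ_2$. Their spectrum is $\sigma_n=\{j,j-1,\dots,-j\}$, where $2j+1=n$. Fix $0<\alpha\le\frac12$, and for each $n\ge 1$ let $\alpha_n$ be a real number such that the interval $(0,\alpha_n)$ contains exactly $\lfloor\alpha n\rfloor$ elements of $\sigma_n$. Let $P_{3,\alpha,n}=\mathbb 1_{(0,\alpha_n)}(J_3)$ and $P_{1,n}=\mathbb 1_{(0,\infty)}(J_1)$ be the corresponding spectral (orthogonal) projections. For $0\le s<t\le 1$ let $N_n(s,t)$ be the number of eigenvalues, counted with multiplicity, of $$R_n=P_{3,\alpha,n}\,P_{1,n}\,P_{3,\alpha,n}\in\operatorname{End}\bigl(\operatorname{Im}(P_{3,\alpha,n})\bigr)$$ lying in the closed interval $[s,t]$. Then for every $0<t<\frac12$, $$\lim_{n\to\infty}\frac{1}{\alpha n}N_n(0,t)=\lim_{n\to\infty}\frac{1}{\alpha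 n}N_n(1-t,1)=\frac12,$$ and $$N_n(t,1-t)=\mathcal O(\log n)\qquad (n\to\infty).$$ -/

import Mathlib

open Filter Topology Asymptotics

/-- `J₁, J₂, J₃` are the (self-adjoint) generators of a unitary irreducible representation of
`SU(2)` on `ℂⁿ`, normalised by `[J₁, J₂] = i J₃`, `[J₂, J₃] = i J₁`, `[J₃, J₁] = i J₂`. -/
structure IsSpinTriple {n : ℕ}
    (J₁ J₂ J₃ : Module.End ℂ (EuclideanSpace ℂ (Fin n))) : Prop where
  isSymmetric_one : J₁.IsSymmetric
  isSymmetric_two : J₂.IsSymmetric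
  isSymmetric_three : J₃.IsSymmetric
  comm_one_two : J₁ * J₂ - J₂ * J₁ = Complex.I • J₃
  comm_two_three : J₂ * J₃ - J₃ * J₂ = Complex.I • J₁
  comm_three_one : J₃ * J₁ - J₁ * J₃ = Complex.I • J₂
  /-- The only subspaces invariant under all three operators are the trivial ones. -/
  irreducible : ∀ W : Submodule ℂ (EuclideanSpace ℂ (Fin n)),
    (∀ v ∈ W, J₁ v ∈ W) → (∀ v ∈ W, J₂ v ∈ W) → (∀ v ∈ W, J₃ v ∈ W) → W = ⊥ ∨ W = ⊤

/-- The set `σ_n = {j, j - 1, …, -j}`, where `2 j + 1 = n`. -/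
def spinSpectrum (n : ℕ) : Set ℝ :=
  Set.range fun k : Fin n => ((n : ℝ) - 1) / 2 - (k : ℝ)

/-- The spectral projection `𝟙_S(A)` of a self-adjoint operator `A` on `ℂⁿ`: the orthogonal
projection onto the sum of the eigenspaces of `A` with eigenvalue in `S`. -/
noncomputable def spectralProjection {n : ℕ} (A : Module.End ℂ (EuclideanSpace ℂ (Fin n)))
    (S : Set ℝ) : Module.End ℂ (EuclideanSpace ℂ (Fin n)) :=
  ((⨆ x ∈ S, Module.End.eigenspace A (x : ℂ)).starProjection :
    EuclideanSpace ℂ (Fin n) →L[ℂ] EuclideanSpace ℂ (Fin n))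

/-- The operator `P Q P`, viewed as an endomorphism of the range of `P`. -/
def compression {n : ℕ} (P Q : Module.End ℂ (EuclideanSpace ℂ (Fin n))) :
    Module.End ℂ (LinearMap.range P) :=
  (P * Q * P).restrict fun v _ => LinearMap.mem_range_self P ((Q * P) v)

open Classical in
/-- The number of eigenvalues of `T` lying in the real interval `[s, t]`, counted with (algebraic)
multiplicity. -/
noncomputable def eigenvalueCount {V : Type*} [AddCommGroup V] [Module ℂ V]
    [FiniteDimensional ℂ V] (T : Module.End ℂ V) (s t : ℝ) : ℕ :=
  T.charpoly.roots.countP fun z => ∃ x ∈ Set.Icc s t, z = (x : ℂ)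

/-! Write `P`, `Q` for the projections of `J₃`, `J₁`, let `d` be the rank of `P`, and take weight
bases `e` of `J₃` and `f` of `J₁`. The eigenvalues `λ` of `P Q P` lie in `[0, 1]`, and two sums
control them: `∑ λ = d / 2 + O(1)` and `∑ λ (1 - λ) = O(log n)`. The second forces all but `O(log
n)` eigenvalues close to `0` or `1`, and the first then splits them evenly.

For the trace, rotation by `π` about the third axis fixes each line `ℂ e k` and sends `J₁` to `-J₁`.
Hence `‖Q (e k)‖²` is `1 / 2` up to the part of `e k` in the kernel of `J₁`, which is at most
one-dimensional (`abs_card_sub_two_mul_sum_le`).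

The second sum is `∑ |⟪e k, Q (e l)⟫|²` over `k` inside and `l` outside the index interval of `P`
(`exists_eigenvalues_compression`). As `J₃` is tridiagonal in `f` and `Q` is a cutoff there, `[J₃,
Q]` has rank two and involves only the two vectors of `f` at the cutoff. Its entries bound `|k - l|
|⟪e k, Q (e l)⟫|` (`abs_sub_mul_norm_inner_le`). Those two vectors have `J₁`-eigenvalue in `[-1,
1]`, and their three-term recursion has slowly varying coefficients, so their squared coordinates
are `O(1 / n)` away from the ends (`norm_inner_sq_le`). The entries of `Q` are thus `O(1 / |k - l|)`
near the boundary, and `∑ (k - l)⁻²` across a boundary point is logarithmic. Pairs at distance of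
order `n` contribute `O(1)` (`sum_sq_boundary_le`). -/

open scoped InnerProductSpace

/-! ### Weight bases of irreducible spin triples -/

/-- The matrix element `√((k + 1) (n - 1 - k))` of the lowering operator between the weight vectors
of index `k` and `k + 1`. -/
noncomputable def ladderCoeff (n k : ℕ) : ℝ :=
  √(((k : ℝ) + 1) * ((n : ℝ) - 1 - k))

/-- `e 0, …, e (n - 1)` is an orthonormal weight basis for the spin triple `J₁, J₂, J₃`, continued
by zero, on which `J₁ ± i J₂` act as ladder operators. -/
structure IsLadderBasis {n : ℕ} (J₁ J₂ J₃ : Module.End ℂ (EuclideanSpace ℂ (Fin n)))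
    (e : ℕ → EuclideanSpace ℂ (Fin n)) : Prop where
  orthonormal : Orthonormal ℂ fun k : Fin n => e k
  eq_zero : ∀ k, n ≤ k → e k = 0
  weight : ∀ k, J₃ (e k) = ((((n : ℝ) - 1) / 2 - k : ℝ) : ℂ) • e k
  raise_zero : J₁ (e 0) + Complex.I • J₂ (e 0) = 0
  raise_succ : ∀ k, J₁ (e (k + 1)) + Complex.I • J₂ (e (k + 1)) = (ladderCoeff n k : ℂ) • e k
  lower : ∀ k, J₁ (e k) - Complex.I • J₂ (e k) = (ladderCoeff n k : ℂ) • e (k + 1)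

namespace IsSpinTriple

variable {n : ℕ} {J₁ J₂ J₃ : Module.End ℂ (EuclideanSpace ℂ (Fin n))}

/-- Cyclic symmetry lets every result on weight bases of `J₃` be used for `J₁`. -/
lemma rotate (hJ : IsSpinTriple J₁ J₂ J₃) : IsSpinTriple J₂ J₃ J₁ where
  isSymmetric_one := hJ.isSymmetric_two
  isSymmetric_two := hJ.isSymmetric_three
  isSymmetric_three := hJ.isSymmetric_one
  comm_one_two := hJ.comm_two_three
  comm_two_three := hJ.comm_three_one
  comm_three_one := hJ.comm_one_two
  irreducible W h₂ h₃ h₁ := hJ.irreducible W h₁ h₂ h₃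

lemma comm_one_two_apply (hJ : IsSpinTriple J₁ J₂ J₃) (x) :
    J₁ (J₂ x) = J₂ (J₁ x) + Complex.I • J₃ x := by
  have := LinearMap.congr_fun hJ.comm_one_two x
  simp only [LinearMap.sub_apply, Module.End.mul_apply, LinearMap.smul_apply] at this
  rw [← this]; abel

/-- Lowering shifts the weight by `-1`. -/
lemma weight_lower (hJ : IsSpinTriple J₁ J₂ J₃) (x) (c : ℂ) (hx : J₃ x = c • x) :
    J₃ (J₁ x - Complex.I • J₂ x) = (c - 1) • (J₁ x - Complex.I • J₂ x) := by
  have h1 := hJ.rotate.comm_one_two_apply x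
  have h2 := hJ.rotate.rotate.comm_one_two_apply x
  rw [hx, map_smul] at h1 h2
  rw [← sub_eq_iff_eq_add] at h1
  rw [map_sub, map_smul, h2, ← h1]
  simp only [smul_sub, smul_smul, Complex.I_mul_I]
  module

/-- Raising shifts the weight by `1`. -/
lemma weight_raise (hJ : IsSpinTriple J₁ J₂ J₃) (x) (c : ℂ) (hx : J₃ x = c • x) :
    J₃ (J₁ x + Complex.I • J₂ x) = (c + 1) • (J₁ x + Complex.I • J₂ x) := by
  have h1 := hJ.rotate.comm_one_two_apply x
  have h2 := hJ.rotate.rotate.comm_one_two_apply x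
  rw [hx, map_smul] at h1 h2
  rw [← sub_eq_iff_eq_add] at h1
  rw [map_add, map_smul, h2, ← h1]
  simp only [smul_sub, smul_add, add_smul, smul_smul, Complex.I_mul_I, one_smul]
  module

/-- `J₊ J₋ = J₋ J₊ + 2 J₃`. -/
lemma raise_lower (hJ : IsSpinTriple J₁ J₂ J₃) (x) :
    J₁ (J₁ x - Complex.I • J₂ x) + Complex.I • J₂ (J₁ x - Complex.I • J₂ x) =
      J₁ (J₁ x + Complex.I • J₂ x) - Complex.I • J₂ (J₁ x + Complex.I • J₂ x) +
        (2 : ℂ) • J₃ x := by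
  simp only [map_sub, map_add, map_smul, hJ.comm_one_two_apply x, smul_add, smul_sub, smul_smul,
    Complex.I_mul_I]
  module

/-- There is a highest weight vector. -/
lemma exists_highest_weight (hJ : IsSpinTriple J₁ J₂ J₃) (hn : 0 < n) :
    ∃ (c : ℂ) (v : EuclideanSpace ℂ (Fin n)), v ≠ 0 ∧ J₃ v = c • v ∧
      J₁ v + Complex.I • J₂ v = 0 := by
  have : Nonempty (Fin n) := ⟨⟨0, hn⟩⟩
  obtain ⟨c₀, hc₀⟩ := Module.End.exists_eigenvalue J₃
  -- With the real part of `c` maximal, a nonzero raised vector would be an eigenvector for `c + 1`.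
  obtain ⟨c, hc, hmax⟩ := Set.exists_max_image {c | J₃.HasEigenvalue c} Complex.re
    J₃.finite_hasEigenvalue ⟨c₀, hc₀⟩
  obtain ⟨v, hv⟩ := hc.exists_hasEigenvector
  refine ⟨c, v, hv.2, hv.apply_eq_smul, ?_⟩
  by_contra h
  have := hmax (c + 1) (Module.End.hasEigenvalue_of_hasEigenvector
    (Module.End.hasEigenvector_iff.2
      ⟨Module.End.mem_eigenspace_iff.2 (hJ.weight_raise v c hv.apply_eq_smul), h⟩))
  simp at this
  linarith

/-- The action of the triple on the vectors obtained from a highest weight vector by lowering. -/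
lemma raise_lower_iterate (hJ : IsSpinTriple J₁ J₂ J₃) {c : ℂ} {v : ℕ → EuclideanSpace ℂ (Fin n)}
    (hw : ∀ k : ℕ, J₃ (v k) = (c - k) • v k) (h₀ : J₁ (v 0) + Complex.I • J₂ (v 0) = 0)
    (hv : ∀ k, v (k + 1) = J₁ (v k) - Complex.I • J₂ (v k)) (k : ℕ) :
    J₁ (v (k + 1)) + Complex.I • J₂ (v (k + 1)) = ((k + 1) * (2 * c - k) : ℂ) • v k := by
  induction k with
  | zero =>
    rw [hv 0, hJ.raise_lower, h₀, hw]
    simp [smul_smul]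
  | succ k ih =>
    rw [hv (k + 1), hJ.raise_lower, ih, hw, map_smul, map_smul, smul_comm Complex.I, ← smul_sub,
      ← hv k, smul_smul, ← add_smul]
    push_cast
    congr 1
    ring

end IsSpinTriple

namespace IsSpinTriple

variable {n : ℕ} {J₁ J₂ J₃ : Module.End ℂ (EuclideanSpace ℂ (Fin n))}

/-- Lowering and raising are adjoint to each other. -/
lemma inner_lower (hJ : IsSpinTriple J₁ J₂ J₃) (x y) :
    ⟪J₁ x - Complex.I • J₂ x, y⟫_ℂ = ⟪x, J₁ y + Complex.I • J₂ y⟫_ℂ := by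
  rw [inner_sub_left, inner_smul_left, inner_add_right, inner_smul_right,
    hJ.isSymmetric_one x y, hJ.isSymmetric_two x y, Complex.conj_I]
  ring

lemma inner_eq_zero_of_weight (hJ : IsSpinTriple J₁ J₂ J₃) {x y} {a b : ℝ}
    (hx : J₃ x = (a : ℂ) • x) (hy : J₃ y = (b : ℂ) • y) (hab : a ≠ b) : ⟪x, y⟫_ℂ = 0 := by
  have := hJ.isSymmetric_three x y
  rw [hx, hy, inner_smul_left, inner_smul_right, Complex.conj_ofReal] at this
  have h : ((a : ℂ) - b) * ⟪x, y⟫_ℂ = 0 := by rw [sub_mul, this, sub_self]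
  refine (mul_eq_zero.1 h).resolve_left fun h => hab ?_
  exact_mod_cast sub_eq_zero.1 h

/-- An irreducible spin triple has a ladder basis. -/
theorem exists_isLadderBasis (hJ : IsSpinTriple J₁ J₂ J₃) (hn : 0 < n) :
    ∃ e, IsLadderBasis J₁ J₂ J₃ e := by
  obtain ⟨c, v₀, hv₀, hc, hr₀⟩ := hJ.exists_highest_weight hn
  set v : ℕ → EuclideanSpace ℂ (Fin n) := fun k => (fun x => J₁ x - Complex.I • J₂ x)^[k] v₀
    with hvdef
  have hv0 : v 0 = v₀ := rfl
  have hv : ∀ k, v (k + 1) = J₁ (v k) - Complex.I • J₂ (v k) := fun k => by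
    simp only [hvdef, Function.iterate_succ_apply']
  have hw : ∀ k : ℕ, J₃ (v k) = (c - k) • v k := by
    intro k
    induction k with
    | zero => simpa [hv0] using hc
    | succ k ih =>
      rw [hv k, hJ.weight_lower _ _ ih]
      push_cast
      congr 1
      ring
  have hraise := hJ.raise_lower_iterate hw hr₀ hv
  -- Otherwise the weights `c - k` would be infinitely many eigenvalues.
  have hex : ∃ k, v k = 0 := by
    by_contra! h
    refine (Set.infinite_of_injective_forall_mem (f := fun k : ℕ => c - k)
      (s := {c | J₃.HasEigenvalue c}) (fun a b hab => ?_) fun k => ?_) J₃.finite_hasEigenvalue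
    · simpa using hab
    · exact Module.End.hasEigenvalue_of_hasEigenvector
        (Module.End.hasEigenvector_iff.2 ⟨Module.End.mem_eigenspace_iff.2 (hw k), h k⟩)
  classical
  obtain ⟨N, hN0, hNmin⟩ : ∃ N, v N = 0 ∧ ∀ k < N, v k ≠ 0 :=
    ⟨Nat.find hex, Nat.find_spec hex, fun k hk => Nat.find_min hex hk⟩
  have hzero : ∀ k, N ≤ k → v k = 0 := by
    intro k hk
    induction k, hk using Nat.le_induction with
    | base => exact hN0
    | succ k _ ih => simp [hv k, ih]
  have hNpos : 0 < N := Nat.pos_of_ne_zero fun h => hv₀ (by rw [← hv0, ← h, hN0])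
  -- Raising `v (M + 1) = 0` gives `(M + 1) (2 c - M) • v M = 0` with `v M ≠ 0`.
  have hcN : c = ((((N : ℝ) - 1) / 2 : ℝ) : ℂ) := by
    obtain ⟨M, rfl⟩ : ∃ M, N = M + 1 := ⟨N - 1, by omega⟩
    have h := hraise M
    rw [hN0] at h
    simp only [map_zero, smul_zero, add_zero] at h
    have h2 := (smul_eq_zero.1 h.symm).resolve_right (hNmin M (by omega))
    have h3 := (mul_eq_zero.1 h2).resolve_left (by exact_mod_cast Nat.succ_ne_zero M)
    push_cast
    linear_combination h3 / 2
  subst hcN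
  have hw' : ∀ k : ℕ, J₃ (v k) = ((((N : ℝ) - 1) / 2 - k : ℝ) : ℂ) • v k := fun k => by
    rw [hw]; push_cast; rfl
  have hraise' : ∀ k : ℕ, J₁ (v (k + 1)) + Complex.I • J₂ (v (k + 1)) =
      ((((k : ℝ) + 1) * ((N : ℝ) - 1 - k) : ℝ) : ℂ) • v k := fun k => by
    rw [hraise]; push_cast; congr 1; ring
  have hsq : ∀ k < N, ladderCoeff N k * ladderCoeff N k = ((k : ℝ) + 1) * ((N : ℝ) - 1 - k) := by
    intro k hk
    have : (k : ℝ) + 1 ≤ N := by exact_mod_cast hk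
    have : (0 : ℝ) ≤ (N : ℝ) - 1 - k := by linarith
    rw [ladderCoeff, Real.mul_self_sqrt (by positivity)]
  have hnorm : ∀ k, ‖v (k + 1)‖ = ladderCoeff N k * ‖v k‖ := by
    intro k
    rcases lt_or_ge k N with hk | hk
    · have h1 : ⟪v (k + 1), v (k + 1)⟫_ℂ = ⟪v k, J₁ (v (k + 1)) + Complex.I • J₂ (v (k + 1))⟫_ℂ := by
        rw [← hJ.inner_lower, ← hv]
      rw [hraise', inner_smul_right, inner_self_eq_norm_sq_to_K, inner_self_eq_norm_sq_to_K,
        ← hsq k hk] at h1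
      have h2 : ‖v (k + 1)‖ ^ 2 = (ladderCoeff N k * ‖v k‖) ^ 2 := by
        rw [mul_pow, sq (ladderCoeff N k)]
        refine Complex.ofReal_injective ?_
        push_cast at h1 ⊢
        exact h1
      exact (sq_eq_sq₀ (norm_nonneg _) (mul_nonneg (Real.sqrt_nonneg _) (norm_nonneg _))).1 h2
    · simp [hzero k hk, hzero (k + 1) (by omega)]
  set e : ℕ → EuclideanSpace ℂ (Fin n) := fun k => ((‖v k‖⁻¹ : ℝ) : ℂ) • v k with he
  have hinner : ∀ k l, k ≠ l → ⟪v k, v l⟫_ℂ = 0 := fun k l hkl =>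
    hJ.inner_eq_zero_of_weight (hw' k) (hw' l) (by simpa using hkl)
  have hon : Orthonormal ℂ fun k : Fin N => e k := by
    refine ⟨fun k => ?_, fun k l hkl => ?_⟩
    · have := norm_ne_zero_iff.2 (hNmin k k.2)
      simp [he, norm_smul, this]
    · simp only [he, inner_smul_left, inner_smul_right]
      rw [hinner k l (fun h => hkl (Fin.ext h))]
      simp
  -- The span is stable under raising and lowering, hence under `J₁` and `J₂`, so irreducibility
  -- applies.
  have hspan : Submodule.span ℂ (Set.range v) = ⊤ := by
    set W := Submodule.span ℂ (Set.range v)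
    have hvW : ∀ k, v k ∈ W := fun k => Submodule.subset_span ⟨k, rfl⟩
    have hlow : ∀ k, J₁ (v k) - Complex.I • J₂ (v k) ∈ W := fun k => hv k ▸ hvW (k + 1)
    have hup : ∀ k, J₁ (v k) + Complex.I • J₂ (v k) ∈ W := by
      rintro (_ | k)
      · rw [hv0, hr₀]; exact W.zero_mem
      · rw [hraise']; exact W.smul_mem _ (hvW k)
    have key : ∀ J : Module.End ℂ (EuclideanSpace ℂ (Fin n)), (∀ k, J (v k) ∈ W) →
        ∀ x ∈ W, J x ∈ W := fun J h x hx => by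
      have : W ≤ W.comap J := Submodule.span_le.2 (by rintro _ ⟨k, rfl⟩; exact h k)
      exact this hx
    refine (hJ.irreducible W (key _ fun k => ?_) (key _ fun k => ?_) (key _ fun k => ?_)).resolve_left
      fun h => hv₀ ?_
    · have := W.smul_mem (1 / 2 : ℂ) (W.add_mem (hlow k) (hup k))
      convert this using 1
      module
    · have := W.smul_mem (-Complex.I / 2 : ℂ) (W.sub_mem (hup k) (hlow k))
      convert this using 1
      have h2 : (-Complex.I / 2) * (2 * Complex.I) = 1 := by
        linear_combination -Complex.I_mul_I
      have h3 : J₁ (v k) + Complex.I • J₂ (v k) - (J₁ (v k) - Complex.I • J₂ (v k)) =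
        (2 * Complex.I) • J₂ (v k) := by module
      rw [h3, smul_smul, h2, one_smul]
    · rw [hw']
      exact W.smul_mem _ (hvW k)
    · have := hvW 0
      rwa [h, Submodule.mem_bot] at this
  have hspan' : Submodule.span ℂ (Set.range fun k : Fin N => e k) = ⊤ := by
    rw [eq_top_iff, ← hspan, Submodule.span_le]
    rintro _ ⟨k, rfl⟩
    rcases lt_or_ge k N with hk | hk
    · have h1 : e k ∈ Submodule.span ℂ (Set.range fun k : Fin N => e k) :=
        Submodule.subset_span ⟨⟨k, hk⟩, rfl⟩
      have h2 := Submodule.smul_mem _ (‖v k‖ : ℂ) h1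
      have h3 : (‖v k‖ : ℂ) ≠ 0 := by exact_mod_cast norm_ne_zero_iff.2 (hNmin k hk)
      have h4 : (‖v k‖ : ℂ) • e k = v k := by
        simp only [he, smul_smul]
        rw [Complex.ofReal_inv, mul_inv_cancel₀ h3, one_smul]
      rwa [h4] at h2
    · simp [hzero k hk]
  obtain rfl : n = N := by
    have h1 := finrank_span_eq_card hon.linearIndependent
    rw [hspan', finrank_top] at h1
    simpa using h1
  refine ⟨e, hon, fun k hk => by simp [he, hzero k hk], fun k => ?_, ?_, fun k => ?_, fun k => ?_⟩
  · simp only [he, map_smul]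
    rw [hw', smul_comm]
  · simp only [he, map_smul, hv0]
    rw [smul_comm, ← smul_add, hr₀, smul_zero]
  · simp only [he, map_smul]
    rw [smul_comm Complex.I, ← smul_add, hraise', smul_smul, smul_smul]
    rcases lt_or_ge k n with hk | hk
    · rw [← hsq k hk, hnorm, ← Complex.ofReal_mul, ← Complex.ofReal_mul]
      congr 2
      by_cases hs : ladderCoeff n k = 0
      · simp [hs]
      · field_simp
    · simp [hzero k hk]
  · simp only [he, map_smul]
    rw [smul_comm Complex.I, ← smul_sub, ← hv, smul_smul, ← Complex.ofReal_mul]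
    by_cases h : v (k + 1) = 0
    · simp [h]
    · congr 2
      have h1 := norm_ne_zero_iff.2 h
      rw [hnorm] at h1 ⊢
      have h2 := left_ne_zero_of_mul h1
      field_simp

end IsSpinTriple

/-! ### Delocalisation of eigenvectors of `J₁` with small eigenvalue -/

/-- A two-sided discrete Grönwall inequality. -/
lemma le_pow_mul_of_two_sided {E : ℕ → ℝ} {r : ℝ} (hr : 1 ≤ r) (hE : ∀ k, 0 ≤ E k) {p q N : ℕ}
    (hN : q ≤ N) (h₁ : ∀ k, p ≤ k → k + 1 ≤ q → E (k + 1) ≤ r * E k)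
    (h₂ : ∀ k, p ≤ k → k + 1 ≤ q → E k ≤ r * E (k + 1)) {k l : ℕ} (hpk : p ≤ k) (hkq : k ≤ q)
    (hpl : p ≤ l) (hlq : l ≤ q) : E k ≤ r ^ N * E l := by
  have key : ∀ d k, p ≤ k → k + d ≤ q → E (k + d) ≤ r ^ d * E k ∧ E k ≤ r ^ d * E (k + d) := by
    intro d
    induction d with
    | zero => intro k _ _; simp
    | succ d ih =>
      intro k hk hd
      obtain ⟨a, b⟩ := ih k hk (by omega)
      have a' := h₁ (k + d) (by omega) (by omega)
      have b' := h₂ (k + d) (by omega) (by omega)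
      have hr0 : 0 ≤ r := by linarith
      constructor
      · calc E (k + (d + 1)) ≤ r * E (k + d) := a'
          _ ≤ r * (r ^ d * E k) := by gcongr
          _ = r ^ (d + 1) * E k := by ring
      · calc E k ≤ r ^ d * E (k + d) := b
          _ ≤ r ^ d * (r * E (k + d + 1)) := by gcongr
          _ = r ^ (d + 1) * E (k + (d + 1)) := by rw [add_assoc]; ring
  rcases le_total k l with h | h
  · obtain ⟨d, rfl⟩ := Nat.exists_eq_add_of_le h
    refine (key d k hpk hlq).2.trans ?_
    gcongr
    · exact hE _
    · omega
  · obtain ⟨d, rfl⟩ := Nat.exists_eq_add_of_le h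
    refine (key d l hpl hkq).1.trans ?_
    gcongr
    · exact hE _
    · omega

lemma ladderCoeff_nonneg (n k : ℕ) : 0 ≤ ladderCoeff n k := Real.sqrt_nonneg _

lemma ladderCoeff_le (n k : ℕ) : ladderCoeff n k ≤ n / 2 := by
  refine Real.sqrt_le_iff.2 ⟨by positivity, ?_⟩
  nlinarith [sq_nonneg ((k : ℝ) + 1 - (n - 1 - k))]

lemma le_ladderCoeff {n k p : ℕ} (hpk : p ≤ k + 1) (hk : k + 1 + p ≤ n) :
    (p : ℝ) ≤ ladderCoeff n k := by
  refine Real.le_sqrt_of_sq_le ?_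
  have h1 : (p : ℝ) ≤ k + 1 := by exact_mod_cast hpk
  have h2 : (k : ℝ) + 1 + p ≤ n := by exact_mod_cast hk
  have h3 : (0 : ℝ) ≤ p := by positivity
  nlinarith

/-- The squares differ by `n - 3 - 2 k`, while the sum of the two coefficients is at least `p`. -/
lemma abs_ladderCoeff_sub_le {n k p : ℕ} (hp : 0 < p) (hpk : p ≤ k) (hk : k + 2 + p ≤ n) :
    |ladderCoeff n (k + 1) - ladderCoeff n k| ≤ n / p := by
  have a := le_ladderCoeff (n := n) (k := k) (p := p) (by omega) (by omega)
  have b := le_ladderCoeff (n := n) (k := k + 1) (p := p) (by omega) (by omega)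
  have hp' : (0 : ℝ) < p := by exact_mod_cast hp
  have hk' : (k : ℝ) + 2 + p ≤ n := by exact_mod_cast hk
  have hk0 : (0 : ℝ) ≤ k := by positivity
  have sa : ladderCoeff n k ^ 2 = ((k : ℝ) + 1) * (n - 1 - k) := by
    rw [ladderCoeff, Real.sq_sqrt]
    have : (0 : ℝ) ≤ (n : ℝ) - 1 - k := by linarith
    positivity
  have sb : ladderCoeff n (k + 1) ^ 2 = ((k : ℝ) + 2) * (n - 2 - k) := by
    rw [ladderCoeff, Real.sq_sqrt]
    · push_cast; ring
    · have : (0 : ℝ) ≤ (n : ℝ) - 1 - (k + 1 : ℕ) := by push_cast; linarith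
      positivity
  rw [le_div_iff₀ hp']
  calc |ladderCoeff n (k + 1) - ladderCoeff n k| * p
      ≤ |ladderCoeff n (k + 1) - ladderCoeff n k| * |ladderCoeff n (k + 1) + ladderCoeff n k| := by
        gcongr
        rw [abs_of_nonneg (by linarith)]
        linarith
    _ = |(n : ℝ) - 3 - 2 * k| := by
        rw [← abs_mul]
        congr 1
        linear_combination sb - sa
    _ ≤ n := by rw [abs_le]; constructor <;> linarith

/-- The recursion of a three-term relation with slowly varying coefficients. -/
lemma norm_le_of_three_term {n p : ℕ} {s s' μ : ℝ} {x y z : ℂ} (hp : 0 < p) (hpn : p ≤ n)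
    (hs : (p : ℝ) ≤ s) (hs' : (p : ℝ) ≤ s') (hss : |s' - s| ≤ n / p) (hμ : |μ| ≤ 1)
    (h : 2 * μ * y = s * x + s' * z) :
    ‖z‖ ≤ (1 + 2 * n / p ^ 2) * ‖x‖ + 2 * n / p ^ 2 * ‖y‖ := by
  have hp' : (0 : ℝ) < p := by exact_mod_cast hp
  have hpn' : (p : ℝ) ≤ n := by exact_mod_cast hpn
  have h1 : s' * ‖z‖ ≤ s * ‖x‖ + 2 * ‖y‖ := by
    have h2 : (s' : ℂ) * z = 2 * μ * y - s * x := by linear_combination -h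
    calc s' * ‖z‖ = ‖(s' : ℂ) * z‖ := by
          rw [norm_mul, Complex.norm_real, Real.norm_of_nonneg (by linarith)]
      _ ≤ ‖2 * (μ : ℂ) * y‖ + ‖(s : ℂ) * x‖ := by rw [h2]; exact norm_sub_le _ _
      _ = 2 * |μ| * ‖y‖ + s * ‖x‖ := by
          simp [Complex.norm_real, Real.norm_of_nonneg (hp'.le.trans hs)]
      _ ≤ 2 * 1 * ‖y‖ + s * ‖x‖ := by gcongr
      _ = _ := by ring
  have hs0 : 0 < s' := by linarith
  have h3 : s ≤ s' + n / p := by linarith [(abs_le.1 hss).1]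
  -- Both `n / p` and `2` are absorbed into `s' * (2 n / p²)` because `s' ≥ p` and `n ≥ p`.
  have h4 : (n : ℝ) / p ≤ s' * (2 * n / p ^ 2) := by
    rw [div_le_iff₀ hp']
    have : s' * (2 * n / p ^ 2) * p = (s' / p) * (2 * n) := by field_simp
    rw [this]
    have : 1 ≤ s' / p := by rwa [le_div_iff₀ hp', one_mul]
    nlinarith
  have h5 : (2 : ℝ) ≤ s' * (2 * n / p ^ 2) := by
    have h6 : (1 : ℝ) ≤ n / p := by rwa [le_div_iff₀ hp', one_mul]
    have : s' * (2 * n / p ^ 2) = 2 * ((s' / p) * (n / p)) := by field_simp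
    rw [this]
    have : 1 ≤ s' / p := by rwa [le_div_iff₀ hp', one_mul]
    nlinarith
  have h7 : s' * ‖z‖ ≤ s' * ((1 + 2 * n / p ^ 2) * ‖x‖ + 2 * n / p ^ 2 * ‖y‖) := by
    refine h1.trans ?_
    have := mul_le_mul_of_nonneg_right (h3.trans (add_le_add_right h4 s')) (norm_nonneg x)
    have := mul_le_mul_of_nonneg_right h5 (norm_nonneg y)
    nlinarith
  exact le_of_mul_le_mul_left h7 hs0

namespace IsLadderBasis

variable {n : ℕ} {J₁ J₂ J₃ : Module.End ℂ (EuclideanSpace ℂ (Fin n))}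
  {e : ℕ → EuclideanSpace ℂ (Fin n)}

lemma exists_orthonormalBasis (he : IsLadderBasis J₁ J₂ J₃ e) :
    ∃ b : OrthonormalBasis (Fin n) ℂ (EuclideanSpace ℂ (Fin n)), ∀ k, b k = e k := by
  refine ⟨OrthonormalBasis.mk he.orthonormal ?_, fun k => by rw [OrthonormalBasis.coe_mk]⟩
  exact (he.orthonormal.linearIndependent.span_eq_top_of_card_eq_finrank' (by simp)).ge

lemma sum_norm_inner_sq (he : IsLadderBasis J₁ J₂ J₃ e) (x) :
    ∑ k ∈ Finset.range n, ‖⟪e k, x⟫_ℂ‖ ^ 2 = ‖x‖ ^ 2 := by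
  obtain ⟨b, hb⟩ := he.exists_orthonormalBasis
  rw [← b.sum_sq_norm_inner_right, Finset.sum_range]
  simp [hb]

lemma two_smul_one_zero (he : IsLadderBasis J₁ J₂ J₃ e) :
    (2 : ℂ) • J₁ (e 0) = (ladderCoeff n 0 : ℂ) • e 1 := by
  rw [← he.lower 0, two_smul]
  nth_rw 2 [← sub_zero (J₁ (e 0))]
  rw [← he.raise_zero]
  abel_nf

lemma two_smul_one_succ (he : IsLadderBasis J₁ J₂ J₃ e) (k : ℕ) :
    (2 : ℂ) • J₁ (e (k + 1)) =
      (ladderCoeff n k : ℂ) • e k + (ladderCoeff n (k + 1) : ℂ) • e (k + 2) := by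
  rw [← he.lower (k + 1), ← he.raise_succ k]
  module

/-- Coordinates of an eigenvector of `J₁` satisfy a three-term recursion. -/
lemma three_term (he : IsLadderBasis J₁ J₂ J₃ e) (hJ : J₁.IsSymmetric) {μ : ℝ} {v}
    (hv : J₁ v = (μ : ℂ) • v) (k : ℕ) :
    2 * μ * ⟪e (k + 1), v⟫_ℂ =
      ladderCoeff n k * ⟪e k, v⟫_ℂ + ladderCoeff n (k + 1) * ⟪e (k + 2), v⟫_ℂ := by
  have h := congrArg (fun y => ⟪y, v⟫_ℂ) (he.two_smul_one_succ k)
  simp only [inner_add_left, inner_smul_left, Complex.conj_ofReal, hJ _ v, hv, inner_smul_right,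
    Complex.conj_ofNat] at h
  rw [← h, mul_assoc]

/-- Eigenvectors of `J₁` with small eigenvalue are delocalised away from the edges of the
spectrum of `J₃`. -/
theorem norm_inner_sq_le (he : IsLadderBasis J₁ J₂ J₃ e) (hJ : J₁.IsSymmetric) {μ : ℝ} {v}
    (hv : J₁ v = (μ : ℂ) • v) (hμ : |μ| ≤ 1) {p : ℕ} (hp : 0 < p) (hpn : 4 * p ≤ n) {δ : ℝ}
    (hδ : 0 < δ) (hδp : δ * n ≤ p) {k : ℕ} (hpk : p ≤ k) (hkp : k + p ≤ n) :
    n * ‖⟪e k, v⟫_ℂ‖ ^ 2 ≤ 8 * Real.exp (4 / δ ^ 2) * ‖v‖ ^ 2 := by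
  set x : ℕ → ℝ := fun k => ‖⟪e k, v⟫_ℂ‖ with hx
  set η : ℝ := 2 * n / p ^ 2 with hη
  have hη0 : 0 ≤ η := by positivity
  have hx0 : ∀ k, 0 ≤ x k := fun k => norm_nonneg _
  have hp' : (0 : ℝ) < p := by exact_mod_cast hp
  have hpn' : 4 * (p : ℝ) ≤ n := by exact_mod_cast hpn
  have hn' : (0 : ℝ) < n := by linarith
  have rec₁ : ∀ k, p ≤ k → k + 2 + p ≤ n → x (k + 2) ≤ (1 + η) * x k + η * x (k + 1) :=
    fun k h₁ h₂ => norm_le_of_three_term hp (by omega) (le_ladderCoeff (by omega) (by omega))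
      (le_ladderCoeff (by omega) (by omega)) (abs_ladderCoeff_sub_le hp h₁ h₂) hμ
      (he.three_term hJ hv k)
  -- The recursion is symmetric under exchanging its outer terms, so it also runs downwards.
  have rec₂ : ∀ k, p ≤ k → k + 2 + p ≤ n → x k ≤ (1 + η) * x (k + 2) + η * x (k + 1) :=
    fun k h₁ h₂ => norm_le_of_three_term (s := ladderCoeff n (k + 1)) (s' := ladderCoeff n k) hp
      (by omega) (le_ladderCoeff (by omega) (by omega)) (le_ladderCoeff (by omega) (by omega))
      (by rw [abs_sub_comm]; exact abs_ladderCoeff_sub_le hp h₁ h₂) hμ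
      (by rw [he.three_term hJ hv k, add_comm])
  -- The loss over `n` steps stays bounded: `n η = 2 n² / p² ≤ 2 / δ²`.
  have hpow : (1 + η) ^ n ≤ Real.exp (2 / δ ^ 2) := by
    calc (1 + η) ^ n ≤ Real.exp η ^ n := by
          gcongr
          rw [add_comm]
          exact Real.add_one_le_exp η
      _ = Real.exp (n * η) := by rw [← Real.exp_nat_mul]
      _ ≤ Real.exp (2 / δ ^ 2) := by
          rw [Real.exp_le_exp, hη, ← mul_div_assoc, div_le_div_iff₀ (by positivity) (by positivity)]
          have := mul_self_le_mul_self (by positivity) hδp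
          nlinarith
  -- Adding `x (k + 1)` to both sides of the recursion makes it a one-step bound for `E` with ratio
  -- `1 + η`.
  set E : ℕ → ℝ := fun k => x k + x (k + 1) with hE
  have hE0 : ∀ k, 0 ≤ E k := fun k => add_nonneg (hx0 _) (hx0 _)
  have hEE : ∀ k l, p ≤ k → k + 1 + p ≤ n → p ≤ l → l + 1 + p ≤ n →
      E k ≤ Real.exp (2 / δ ^ 2) * E l := by
    intro k l h₁ h₂ h₃ h₄
    refine (le_pow_mul_of_two_sided (r := 1 + η) (p := p) (q := n - 1 - p) (N := n) (by linarith)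
      hE0 (by omega) (fun k h h' => ?_) (fun k h h' => ?_) h₁ (by omega) h₃ (by omega)).trans
      (mul_le_mul_of_nonneg_right hpow (hE0 l))
    · have := rec₁ k h (by omega)
      simp only [hE]
      linarith
    · have := rec₂ k h (by omega)
      simp only [hE]
      linarith
  -- At the last index `k = n - p`, the pair starting at `k - 1` must be used.
  obtain ⟨k', hk₁, hk₂, hk₃⟩ : ∃ k', p ≤ k' ∧ k' + 1 + p ≤ n ∧ x k ≤ E k' := by
    rcases Nat.lt_or_ge (k + p) n with h | h
    · exact ⟨k, hpk, by omega, by simp only [hE]; linarith [hx0 (k + 1)]⟩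
    · refine ⟨k - 1, by omega, by omega, ?_⟩
      simp only [hE]
      rw [Nat.sub_add_cancel (by omega)]
      linarith [hx0 (k - 1)]
  have hpt : ∀ l ∈ Finset.Ico p (n - p), x k ^ 2 ≤
      Real.exp (4 / δ ^ 2) * (2 * x l ^ 2 + 2 * x (l + 1) ^ 2) := by
    intro l hl
    rw [Finset.mem_Ico] at hl
    calc x k ^ 2 ≤ (Real.exp (2 / δ ^ 2) * E l) ^ 2 := by
          have := hk₃.trans (hEE k' l hk₁ hk₂ hl.1 (by omega))
          have := hx0 k
          gcongr
      _ = Real.exp (4 / δ ^ 2) * E l ^ 2 := by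
          rw [mul_pow, ← Real.exp_nat_mul]
          congr 2
          push_cast
          ring
      _ ≤ _ := by
          gcongr
          simp only [hE]
          nlinarith [sq_nonneg (x l - x (l + 1))]
  -- Averaging over `n - 2 p ≥ n / 2` indices `l` against total mass `‖v‖²` gives the factor `1 /
  -- n`.
  have hsum := Finset.sum_le_sum hpt
  rw [Finset.sum_const, nsmul_eq_mul, Nat.card_Ico, ← Finset.mul_sum, Finset.sum_add_distrib,
    ← Finset.mul_sum, ← Finset.mul_sum] at hsum
  have hs₁ : ∑ l ∈ Finset.Ico p (n - p), x l ^ 2 ≤ ‖v‖ ^ 2 := by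
    rw [← he.sum_norm_inner_sq v]
    refine Finset.sum_le_sum_of_subset_of_nonneg (fun l hl => ?_) fun _ _ _ => sq_nonneg _
    simp only [Finset.mem_Ico, Finset.mem_range] at hl ⊢
    omega
  have hs₂ : ∑ l ∈ Finset.Ico p (n - p), x (l + 1) ^ 2 ≤ ‖v‖ ^ 2 := by
    rw [← he.sum_norm_inner_sq v, Finset.sum_Ico_add' (fun l => x l ^ 2) p (n - p) 1]
    refine Finset.sum_le_sum_of_subset_of_nonneg (fun l hl => ?_) fun _ _ _ => sq_nonneg _
    simp only [Finset.mem_Ico, Finset.mem_range] at hl ⊢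
    omega
  have hcard : (n : ℝ) / 2 ≤ ((n - p - p : ℕ) : ℝ) := by
    rw [Nat.cast_sub (by omega), Nat.cast_sub (by omega)]
    linarith
  have h₁ := mul_le_mul_of_nonneg_right hcard (sq_nonneg (x k))
  have h₂ : Real.exp (4 / δ ^ 2) * (2 * ∑ l ∈ Finset.Ico p (n - p), x l ^ 2 +
      2 * ∑ l ∈ Finset.Ico p (n - p), x (l + 1) ^ 2) ≤
      Real.exp (4 / δ ^ 2) * (2 * ‖v‖ ^ 2 + 2 * ‖v‖ ^ 2) := by gcongr
  linarith

end IsLadderBasis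

/-! ### Spectral projections on eigenvectors -/

section SpectralProjection

variable {n : ℕ} {A : Module.End ℂ (EuclideanSpace ℂ (Fin n))} {S : Set ℝ}

lemma spectralProjection_apply_of_mem {x : ℝ} (hx : x ∈ S) {v} (hv : A v = (x : ℂ) • v) :
    spectralProjection A S v = v := by
  refine Submodule.starProjection_eq_self_iff.2 ?_
  exact Submodule.mem_iSup_of_mem x (Submodule.mem_iSup_of_mem hx
    (Module.End.mem_eigenspace_iff.2 hv))

lemma spectralProjection_apply_of_notMem (hA : A.IsSymmetric) {x : ℝ} (hx : x ∉ S) {v}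
    (hv : A v = (x : ℂ) • v) : spectralProjection A S v = 0 := by
  refine (Submodule.starProjection_apply_eq_zero_iff _).2 ?_
  rw [Submodule.mem_orthogonal]
  intro u hu
  have hle : (⨆ y ∈ S, Module.End.eigenspace A (y : ℂ)) ≤ (ℂ ∙ v)ᗮ := by
    refine iSup₂_le fun y hy w hw => ?_
    rw [Submodule.mem_orthogonal_singleton_iff_inner_left]
    have hw := Module.End.mem_eigenspace_iff.1 hw
    have := hA w v
    rw [hw, hv, inner_smul_left, inner_smul_right, Complex.conj_ofReal] at this
    have h : ((y : ℂ) - x) * ⟪w, v⟫_ℂ = 0 := by rw [sub_mul, this, sub_self]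
    refine (mul_eq_zero.1 h).resolve_left fun h => hx ?_
    have h : y = x := by exact_mod_cast sub_eq_zero.1 h
    rwa [← h]
  exact Submodule.mem_orthogonal_singleton_iff_inner_left.1 (hle hu)

lemma isSymmetric_spectralProjection : (spectralProjection A S).IsSymmetric :=
  Submodule.starProjection_isSymmetric _

lemma spectralProjection_idem (x) :
    spectralProjection A S (spectralProjection A S x) = spectralProjection A S x :=
  Submodule.starProjection_eq_self_iff.2 (Submodule.starProjection_apply_mem _ _)

end SpectralProjection

/-! ### Commutators with a cutoff and off-diagonal decay -/

namespace IsLadderBasis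

variable {n : ℕ} {J₁ J₂ J₃ : Module.End ℂ (EuclideanSpace ℂ (Fin n))}
  {e f : ℕ → EuclideanSpace ℂ (Fin n)} {P : Module.End ℂ (EuclideanSpace ℂ (Fin n))}

open Classical in
lemma spectralProjection_apply (he : IsLadderBasis J₁ J₂ J₃ e) (hJ : J₃.IsSymmetric) (S : Set ℝ)
    (k : ℕ) : spectralProjection J₃ S (e k) =
      if ((n : ℝ) - 1) / 2 - k ∈ S then e k else 0 := by
  split_ifs with h
  · exact spectralProjection_apply_of_mem h (he.weight k)
  · exact spectralProjection_apply_of_notMem hJ h (he.weight k)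

lemma linearMap_ext (he : IsLadderBasis J₁ J₂ J₃ e) {V : Type*} [AddCommGroup V] [Module ℂ V]
    {S T : EuclideanSpace ℂ (Fin n) →ₗ[ℂ] V} (h : ∀ k < n, S (e k) = T (e k)) : S = T := by
  obtain ⟨b, hb⟩ := he.exists_orthonormalBasis
  refine b.toBasis.ext fun k => ?_
  rw [b.coe_toBasis, hb, h k k.2]

lemma inner_eq (he : IsLadderBasis J₁ J₂ J₃ e) {k l : ℕ} (hk : k < n) :
    ⟪e k, e l⟫_ℂ = if k = l then 1 else 0 := by
  rcases lt_or_ge l n with hl | hl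
  · have := orthonormal_iff_ite.1 he.orthonormal ⟨k, hk⟩ ⟨l, hl⟩
    simpa using this
  · rw [he.eq_zero l hl, inner_zero_right, if_neg (by omega)]

/-- Lowering preserves the range and the kernel of the cutoff except at the one step from `m` to `m
+ 1`. -/
lemma comm_lower (hf : IsLadderBasis J₁ J₂ J₃ f) {m : ℕ} (hm : m < n)
    (hP : ∀ i, P (f i) = if i ≤ m then f i else 0) (x) :
    (J₁ (P x) - Complex.I • J₂ (P x)) - P (J₁ x - Complex.I • J₂ x) =
      (ladderCoeff n m * ⟪f m, x⟫_ℂ) • f (m + 1) := by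
  have : (J₁ - Complex.I • J₂) ∘ₗ P - P ∘ₗ (J₁ - Complex.I • J₂) =
      (ladderCoeff n m : ℂ) • (innerₛₗ ℂ (f m)).smulRight (f (m + 1)) := by
    refine hf.linearMap_ext fun i hi => ?_
    simp only [LinearMap.sub_apply, LinearMap.comp_apply, LinearMap.smul_apply,
      LinearMap.smulRight_apply, innerₛₗ_apply_apply, hf.inner_eq hm]
    rw [hf.lower, map_smul, hP, hP]
    rcases lt_trichotomy i m with h | rfl | h
    · rw [if_pos h.le, if_pos (by omega), if_neg (by omega), hf.lower]
      simp
    · simp [hf.lower]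
    · rw [if_neg (by omega), if_neg (by omega), if_neg (by omega)]
      simp
  have := LinearMap.congr_fun this x
  rw [mul_smul]
  exact this

lemma comm_raise (hf : IsLadderBasis J₁ J₂ J₃ f) {m : ℕ} (hm : m + 1 < n)
    (hP : ∀ i, P (f i) = if i ≤ m then f i else 0) (x) :
    (J₁ (P x) + Complex.I • J₂ (P x)) - P (J₁ x + Complex.I • J₂ x) =
      (-(ladderCoeff n m * ⟪f (m + 1), x⟫_ℂ)) • f m := by
  have : (J₁ + Complex.I • J₂) ∘ₗ P - P ∘ₗ (J₁ + Complex.I • J₂) =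
      (-(ladderCoeff n m : ℂ)) • (innerₛₗ ℂ (f (m + 1))).smulRight (f m) := by
    refine hf.linearMap_ext fun i hi => ?_
    simp only [LinearMap.sub_apply, LinearMap.add_apply, LinearMap.comp_apply,
      LinearMap.smul_apply, LinearMap.smulRight_apply, innerₛₗ_apply_apply, hf.inner_eq hm]
    obtain _ | i := i
    · rw [hf.raise_zero, hP, if_pos (by omega), hf.raise_zero, if_neg (by omega)]
      simp
    · rw [hf.raise_succ, map_smul, hP, hP]
      rcases lt_trichotomy i m with h | rfl | h
      · rw [if_pos (by omega), if_pos (by omega), if_neg (by omega), hf.raise_succ]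
        simp
      · simp
      · rw [if_neg (by omega), if_neg (by omega), if_neg (by omega)]
        simp
  have := LinearMap.congr_fun this x
  rw [neg_smul, mul_smul, ← neg_smul]
  exact this

/-- The commutator of `J₂` with a spectral projection of `J₃` has rank two. -/
lemma comm_two (hf : IsLadderBasis J₁ J₂ J₃ f) {m : ℕ} (hm : m + 1 < n)
    (hP : ∀ i, P (f i) = if i ≤ m then f i else 0) (x) :
    J₂ (P x) - P (J₂ x) = (Complex.I * (ladderCoeff n m / 2)) •
      (⟪f (m + 1), x⟫_ℂ • f m + ⟪f m, x⟫_ℂ • f (m + 1)) := by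
  have h₁ := hf.comm_lower (by omega) hP x
  have h₂ := hf.comm_raise hm hP x
  have h₃ : (2 * Complex.I) • (J₂ (P x) - P (J₂ x)) =
      (-(ladderCoeff n m * ⟪f (m + 1), x⟫_ℂ)) • f m -
      (ladderCoeff n m * ⟪f m, x⟫_ℂ) • f (m + 1) := by
    rw [← h₁, ← h₂, map_sub, map_add, map_smul]
    module
  have h₄ : (-Complex.I / 2) * (2 * Complex.I) = 1 := by linear_combination -Complex.I_mul_I
  rw [← one_smul ℂ (J₂ (P x) - P (J₂ x)), ← h₄, mul_smul, h₃]
  module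

/-- Off-diagonal decay of a spectral projection of `J₁` in the weight basis of `J₃`. -/
theorem abs_sub_mul_norm_inner_le (he : IsLadderBasis J₁ J₂ J₃ e) (hf : IsLadderBasis J₂ J₃ J₁ f)
    (hJ : J₃.IsSymmetric) {m : ℕ} (hm : m + 1 < n) (hP : ∀ i, P (f i) = if i ≤ m then f i else 0)
    (k l : ℕ) : |(k : ℝ) - l| * ‖⟪e k, P (e l)⟫_ℂ‖ ≤ n / 4 *
      (‖⟪e k, f m⟫_ℂ‖ * ‖⟪e l, f (m + 1)⟫_ℂ‖ + ‖⟪e k, f (m + 1)⟫_ℂ‖ * ‖⟪e l, f m⟫_ℂ‖) := by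
  -- `J₃` is the second operator of the triple to which `f` is adapted, so `comm_two` evaluates this
  -- commutator.
  have h₁ : (((l : ℝ) - k : ℝ) : ℂ) * ⟪e k, P (e l)⟫_ℂ = ⟪e k, J₃ (P (e l)) - P (J₃ (e l))⟫_ℂ := by
    rw [inner_sub_right, ← hJ, he.weight, he.weight, map_smul, inner_smul_left, inner_smul_right,
      Complex.conj_ofReal]
    push_cast
    ring
  rw [hf.comm_two hm hP, inner_smul_right, inner_add_right, inner_smul_right, inner_smul_right]
    at h₁
  rw [abs_sub_comm, ← Real.norm_eq_abs, ← Complex.norm_real, ← norm_mul, h₁, norm_mul]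
  have h₂ : ‖Complex.I * ((ladderCoeff n m : ℂ) / 2)‖ ≤ n / 4 := by
    rw [norm_mul, Complex.norm_I, one_mul, norm_div, Complex.norm_real,
      Real.norm_of_nonneg (ladderCoeff_nonneg _ _)]
    have := ladderCoeff_le n m
    simp only [Complex.norm_ofNat]
    linarith
  refine mul_le_mul h₂ ((norm_add_le _ _).trans_eq ?_) (norm_nonneg _) (by positivity)
  rw [norm_mul, norm_mul, norm_inner_symm (f m) (e l), norm_inner_symm (f (m + 1)) (e l)]
  ring

end IsLadderBasis

/-! ### Logarithmic sums across the boundary of an interval -/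

/-- For fixed `k` the inner sum is a tail of `∑ i⁻²` from `i = b - k`, at most `2 / (b - k)`; the
outer sum is then harmonic. -/
lemma sum_inv_sq_across_le (a b c : ℕ) :
    ∑ k ∈ Finset.Ico a b, ∑ l ∈ Finset.Ico b c, (((k : ℝ) - l) ^ 2)⁻¹ ≤
      2 * (1 + Real.log b) := by
  have h₁ : ∀ k ∈ Finset.Ico a b, ∑ l ∈ Finset.Ico b c, (((k : ℝ) - l) ^ 2)⁻¹ ≤
      2 * (((b - 1 - k : ℕ) : ℝ) + 1)⁻¹ := by
    intro k hk
    rw [Finset.mem_Ico] at hk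
    rw [← div_eq_mul_inv]
    refine le_trans ?_ (sum_Ioo_inv_sq_le (b - 1 - k) (c - k))
    have : Finset.Ico b c = (Finset.Ioo (b - 1 - k) (c - k)).map (addRightEmbedding k) := by
      ext l
      simp only [Finset.mem_Ico, Finset.mem_map, Finset.mem_Ioo, addRightEmbedding_apply]
      refine ⟨fun h => ⟨l - k, by omega, by omega⟩, ?_⟩
      rintro ⟨l, h, rfl⟩
      omega
    rw [this, Finset.sum_map]
    refine le_of_eq (Finset.sum_congr rfl fun i _ => ?_)
    simp
  calc _ ≤ ∑ k ∈ Finset.Ico a b, 2 * (((b - 1 - k : ℕ) : ℝ) + 1)⁻¹ := Finset.sum_le_sum h₁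
    _ ≤ ∑ k ∈ Finset.range b, 2 * (((b - 1 - k : ℕ) : ℝ) + 1)⁻¹ := by
        refine Finset.sum_le_sum_of_subset_of_nonneg (fun k hk => ?_) fun _ _ _ => by positivity
        rw [Finset.mem_Ico] at hk
        exact Finset.mem_range.2 hk.2
    _ = 2 * ((harmonic b : ℚ) : ℝ) := by
        rw [Finset.sum_range_reflect (fun i : ℕ => 2 * ((i : ℝ) + 1)⁻¹) b, ← Finset.mul_sum,
          harmonic]
        push_cast
        rfl
    _ ≤ _ := by gcongr; exact harmonic_le_one_add_log b

lemma sum_inv_sq_boundary_le {a b n : ℕ} (hab : a ≤ b) (hbn : b ≤ n) :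
    ∑ k ∈ Finset.Ico a b, ∑ l ∈ Finset.range n \ Finset.Ico a b, (((k : ℝ) - l) ^ 2)⁻¹ ≤
      4 * (1 + Real.log n) := by
  have hmono : ∀ c : ℕ, c ≤ n → Real.log c ≤ Real.log n := by
    intro c hc
    rcases Nat.eq_zero_or_pos c with rfl | h
    · simpa using Real.log_natCast_nonneg n
    · gcongr
  have hset : Finset.range n \ Finset.Ico a b = Finset.Ico 0 a ∪ Finset.Ico b n := by
    ext l
    simp only [Finset.mem_sdiff, Finset.mem_range, Finset.mem_Ico, Finset.mem_union]
    omega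
  have hdisj : Disjoint (Finset.Ico 0 a) (Finset.Ico b n) := by
    rw [Finset.disjoint_left]
    simp only [Finset.mem_Ico]
    omega
  simp only [hset, Finset.sum_union hdisj, Finset.sum_add_distrib]
  have h₁ := sum_inv_sq_across_le a b n
  have h₂ := sum_inv_sq_across_le 0 a b
  rw [Finset.sum_comm] at h₂
  have h₃ : ∑ k ∈ Finset.Ico a b, ∑ l ∈ Finset.Ico 0 a, (((k : ℝ) - l) ^ 2)⁻¹ =
      ∑ k ∈ Finset.Ico a b, ∑ l ∈ Finset.Ico 0 a, (((l : ℝ) - k) ^ 2)⁻¹ :=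
    Finset.sum_congr rfl fun _ _ => Finset.sum_congr rfl fun _ _ => by rw [← neg_sq, neg_sub]
  have := hmono a (by omega)
  have := hmono b hbn
  linarith

/-- A kernel decaying off the diagonal, with delocalised coefficients near the boundary of an
interval, has logarithmic mass across that boundary. -/
lemma sum_sq_boundary_le {n p a b : ℕ} {C : ℝ} (hn : 1 ≤ n) (hp : 0 < p) (hab : a ≤ b)
    (hbn : b ≤ n) {g : ℕ → ℕ → ℝ} (hg : ∀ k l, 0 ≤ g k l) {U W : ℕ → ℝ}
    (hdecay : ∀ k l : ℕ, |(k : ℝ) - l| * g k l ≤ n / 4 * (U k * W l + W k * U l))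
    (hU1 : ∑ k ∈ Finset.range n, U k ^ 2 ≤ 1) (hW1 : ∑ k ∈ Finset.range n, W k ^ 2 ≤ 1)
    (hUC : ∀ k, p ≤ k → k + p ≤ n → n * U k ^ 2 ≤ C)
    (hWC : ∀ k, p ≤ k → k + p ≤ n → n * W k ^ 2 ≤ C)
    (hbd : ∀ k l : ℕ, a ≤ k → k < b → l < n → (l < a ∨ b ≤ l) → k < l + p → l < k + p →
      p ≤ k ∧ k + p ≤ n ∧ p ≤ l ∧ l + p ≤ n) :
    ∑ k ∈ Finset.Ico a b, ∑ l ∈ Finset.range n \ Finset.Ico a b, g k l ^ 2 ≤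
      n ^ 2 / (4 * p ^ 2) + C ^ 2 * (1 + Real.log n) := by
  have hp' : (0 : ℝ) < p := by exact_mod_cast hp
  have hn' : (0 : ℝ) < n := by exact_mod_cast hn
  -- Near pairs are bounded by the last term through delocalisation, far pairs by the first through
  -- `|k - l| ≥ p`; adding both nonnegative bounds avoids splitting the sum.
  have hpt : ∀ k ∈ Finset.Ico a b, ∀ l ∈ Finset.range n \ Finset.Ico a b,
      g k l ^ 2 ≤ n ^ 2 / (8 * p ^ 2) * (U k ^ 2 * W l ^ 2 + W k ^ 2 * U l ^ 2) +
        C ^ 2 / 4 * (((k : ℝ) - l) ^ 2)⁻¹ := by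
    intro k hk l hl
    simp only [Finset.mem_sdiff, Finset.mem_range, Finset.mem_Ico, not_and, not_lt] at hk hl
    have hkl : (k : ℝ) - l ≠ 0 := by
      rw [sub_ne_zero]
      norm_cast
      omega
    have hpos : 0 < |(k : ℝ) - l| := abs_pos.2 hkl
    have hdec := hdecay k l
    have hsq : ((k : ℝ) - l) ^ 2 * g k l ^ 2 ≤
        n ^ 2 / 8 * (U k ^ 2 * W l ^ 2 + W k ^ 2 * U l ^ 2) := by
      have h := pow_le_pow_left₀ (mul_nonneg hpos.le (hg k l)) hdec 2
      rw [mul_pow, sq_abs] at h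
      refine h.trans ?_
      have := two_mul_le_add_sq (U k * W l) (W k * U l)
      calc ((n : ℝ) / 4 * (U k * W l + W k * U l)) ^ 2
          = n ^ 2 / 16 * (U k * W l + W k * U l) ^ 2 := by ring
        _ ≤ n ^ 2 / 16 * (2 * (U k ^ 2 * W l ^ 2 + W k ^ 2 * U l ^ 2)) := by
            gcongr
            nlinarith
        _ = _ := by ring
    by_cases hnear : k < l + p ∧ l < k + p
    · obtain ⟨h₁, h₂, h₃, h₄⟩ := hbd k l hk.1 hk.2 hl.1 (by omega) hnear.1 hnear.2
      have hC : 0 ≤ C := le_trans (by positivity) (hUC k h₁ h₂)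
      have hUW : ∀ i j, p ≤ i → i + p ≤ n → p ≤ j → j + p ≤ n →
          n ^ 2 * (U i ^ 2 * W j ^ 2) ≤ C ^ 2 := fun i j a₁ a₂ a₃ a₄ => by
        have := mul_le_mul (hUC i a₁ a₂) (hWC j a₃ a₄) (by positivity) hC
        linarith
      have e₁ := hUW k l h₁ h₂ h₃ h₄
      have e₂ := hUW l k h₃ h₄ h₁ h₂
      have h₅ : g k l ^ 2 ≤ C ^ 2 / 4 * (((k : ℝ) - l) ^ 2)⁻¹ := by
        rw [← div_eq_mul_inv, le_div_iff₀ (by positivity)]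
        linarith
      have : 0 ≤ (n : ℝ) ^ 2 / (8 * p ^ 2) * (U k ^ 2 * W l ^ 2 + W k ^ 2 * U l ^ 2) := by
        positivity
      linarith
    · have hfar : (p : ℝ) ^ 2 ≤ ((k : ℝ) - l) ^ 2 := by
        rw [← sq_abs ((k : ℝ) - l)]
        gcongr
        rw [le_abs']
        rcases not_and_or.1 hnear with h | h
        · right
          have : (l : ℝ) + p ≤ k := by exact_mod_cast not_lt.1 h
          linarith
        · left
          have : (k : ℝ) + p ≤ l := by exact_mod_cast not_lt.1 h
          linarith
      have h₅ : g k l ^ 2 ≤ n ^ 2 / (8 * p ^ 2) * (U k ^ 2 * W l ^ 2 + W k ^ 2 * U l ^ 2) := by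
        have h₆ := (mul_le_mul_of_nonneg_right hfar (sq_nonneg (g k l))).trans hsq
        have : (n : ℝ) ^ 2 / (8 * p ^ 2) * (U k ^ 2 * W l ^ 2 + W k ^ 2 * U l ^ 2) =
          n ^ 2 / 8 * (U k ^ 2 * W l ^ 2 + W k ^ 2 * U l ^ 2) / p ^ 2 := by field_simp
        rw [this, le_div_iff₀ (by positivity)]
        linarith
      have : 0 ≤ C ^ 2 / 4 * (((k : ℝ) - l) ^ 2)⁻¹ := by positivity
      linarith
  have hprod : ∀ u w : ℕ → ℝ, ∑ k ∈ Finset.range n, u k ^ 2 ≤ 1 →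
      ∑ k ∈ Finset.range n, w k ^ 2 ≤ 1 → ∑ k ∈ Finset.Ico a b,
        ∑ l ∈ Finset.range n \ Finset.Ico a b, u k ^ 2 * w l ^ 2 ≤ 1 := by
    intro u w hu hw
    rw [← Finset.sum_mul_sum]
    refine mul_le_one₀ (le_trans (Finset.sum_le_sum_of_subset_of_nonneg (fun k hk => ?_)
      fun _ _ _ => sq_nonneg _) hu) (Finset.sum_nonneg fun _ _ => sq_nonneg _)
      (le_trans (Finset.sum_le_sum_of_subset_of_nonneg Finset.sdiff_subset
      fun _ _ _ => sq_nonneg _) hw)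
    simp only [Finset.mem_Ico, Finset.mem_range] at hk ⊢
    omega
  refine (Finset.sum_le_sum fun k hk => Finset.sum_le_sum (hpt k hk)).trans ?_
  simp only [Finset.sum_add_distrib, ← Finset.mul_sum]
  have h₁ := hprod U W hU1 hW1
  have h₂ := hprod W U hW1 hU1
  have h₃ := sum_inv_sq_boundary_le hab hbn
  simp only [← Finset.mul_sum] at h₁ h₂
  have h₄ : (n : ℝ) ^ 2 / (8 * p ^ 2) * (1 + 1) = n ^ 2 / (4 * p ^ 2) := by field_simp; norm_num
  have h₅ := mul_le_mul_of_nonneg_left (add_le_add h₁ h₂)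
    (by positivity : 0 ≤ (n : ℝ) ^ 2 / (8 * p ^ 2))
  have h₆ := mul_le_mul_of_nonneg_left h₃ (by positivity : 0 ≤ C ^ 2 / 4)
  linarith

/-! ### Trace and boundary mass of the projection of `J₁` -/

namespace IsLadderBasis

variable {n : ℕ} {J₁ J₂ J₃ : Module.End ℂ (EuclideanSpace ℂ (Fin n))}
  {e f : ℕ → EuclideanSpace ℂ (Fin n)} {P : Module.End ℂ (EuclideanSpace ℂ (Fin n))}

lemma norm_eq_one (he : IsLadderBasis J₁ J₂ J₃ e) {k : ℕ} (hk : k < n) : ‖e k‖ = 1 :=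
  he.orthonormal.1 ⟨k, hk⟩

lemma sum_inner_smul (he : IsLadderBasis J₁ J₂ J₃ e) (x) :
    ∑ k ∈ Finset.range n, ⟪e k, x⟫_ℂ • e k = x := by
  obtain ⟨b, hb⟩ := he.exists_orthonormalBasis
  nth_rw 2 [← b.sum_repr' x]
  rw [Finset.sum_range]
  simp [hb]

lemma inner_apply_of_isSymmetric (hP : P.IsSymmetric) {p : ℕ → Prop} [DecidablePred p]
    (hPe : ∀ k, P (e k) = if p k then e k else 0) (k : ℕ) (x) :
    ⟪e k, P x⟫_ℂ = if p k then ⟪e k, x⟫_ℂ else 0 := by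
  rw [← hP, hPe]
  split_ifs <;> simp

lemma norm_apply_sq (he : IsLadderBasis J₁ J₂ J₃ e) (hP : P.IsSymmetric) {p : ℕ → Prop}
    [DecidablePred p] (hPe : ∀ k, P (e k) = if p k then e k else 0) (x) :
    ‖P x‖ ^ 2 = ∑ k ∈ Finset.range n, if p k then ‖⟪e k, x⟫_ℂ‖ ^ 2 else 0 := by
  rw [← he.sum_norm_inner_sq (P x)]
  refine Finset.sum_congr rfl fun k _ => ?_
  rw [inner_apply_of_isSymmetric hP hPe]
  split_ifs <;> simp

/-- Rotation by `π` about the third axis reverses the sign of `J₁`. -/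
lemma norm_inner_reflect (hJ : IsSpinTriple J₁ J₂ J₃) (he : IsLadderBasis J₁ J₂ J₃ e)
    (hf : IsLadderBasis J₂ J₃ J₁ f) {i : ℕ} (hi : i < n) (k : ℕ) :
    ‖⟪f (n - 1 - i), e k⟫_ℂ‖ = ‖⟪f i, e k⟫_ℂ‖ := by
  obtain ⟨b, hb⟩ := he.exists_orthonormalBasis
  -- Up to a phase, this is the rotation by `π` about the third axis. It anticommutes with `J₁`,
  -- which changes the index by one.
  set U : Module.End ℂ (EuclideanSpace ℂ (Fin n)) :=
    b.toBasis.constr ℂ fun k : Fin n => (-1 : ℂ) ^ (k : ℕ) • e k with hUdef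
  have hU : ∀ k, U (e k) = (-1 : ℂ) ^ k • e k := by
    intro k
    rcases lt_or_ge k n with hk | hk
    · rw [← hb ⟨k, hk⟩, hUdef, ← b.coe_toBasis, Module.Basis.constr_basis, b.coe_toBasis, hb]
    · rw [he.eq_zero k hk, map_zero, smul_zero]
  have hsymm : ∀ k x, ⟪e k, U x⟫_ℂ = (-1 : ℂ) ^ k * ⟪e k, x⟫_ℂ := by
    intro k x
    have : (innerₛₗ ℂ (e k)) ∘ₗ U = (-1 : ℂ) ^ k • innerₛₗ ℂ (e k) := by
      refine he.linearMap_ext fun l hl => ?_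
      simp only [LinearMap.comp_apply, hU, map_smul, LinearMap.smul_apply, innerₛₗ_apply_apply]
      rcases eq_or_ne k l with rfl | h
      · rfl
      · have : ⟪e k, e l⟫_ℂ = 0 := by
          rw [← inner_conj_symm, he.inner_eq hl, if_neg h.symm, map_zero]
        rw [this, smul_zero, smul_zero]
    exact LinearMap.congr_fun this x
  have hanti : ∀ x, J₁ (U x) = -U (J₁ x) := by
    have : (2 : ℂ) • (J₁ ∘ₗ U) = (2 : ℂ) • -(U ∘ₗ J₁) := by
      refine he.linearMap_ext fun l _ => ?_
      simp only [LinearMap.comp_apply, LinearMap.smul_apply, LinearMap.neg_apply, hU]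
      rw [smul_neg, ← map_smul U, map_smul J₁, smul_comm]
      obtain _ | l := l
      · rw [he.two_smul_one_zero, map_smul, hU]
        simp
      · rw [he.two_smul_one_succ, map_add, map_smul, map_smul, hU, hU]
        simp only [pow_succ]
        module
    have h := smul_right_injective _ (two_ne_zero' ℂ) this
    exact fun x => LinearMap.congr_fun h x
  have hnorm : ∀ k x, ‖⟪e k, U x⟫_ℂ‖ = ‖⟪e k, x⟫_ℂ‖ := fun k x => by
    rw [hsymm, norm_mul, norm_pow, norm_neg, norm_one, one_pow, one_mul]
  -- `U (f i)` has the opposite weight, and weight spaces are one-dimensional, so it is a multiple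
  -- of `f (n - 1 - i)`.
  set c := ⟪f (n - 1 - i), U (f i)⟫_ℂ
  have hexp : U (f i) = c • f (n - 1 - i) := by
    rw [← hf.sum_inner_smul (U (f i))]
    refine Finset.sum_eq_single_of_mem _ (Finset.mem_range.2 (by omega)) fun l _ hne => ?_
    have hw : J₁ (U (f i)) = ((-(((n : ℝ) - 1) / 2 - i) : ℝ) : ℂ) • U (f i) := by
      rw [hanti, hf.weight, map_smul]
      push_cast
      module
    rw [hJ.rotate.inner_eq_zero_of_weight (hf.weight l) hw, zero_smul]
    intro h
    apply hne
    have : (l : ℝ) = ((n - 1 - i : ℕ) : ℝ) := by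
      rw [Nat.cast_sub (by omega), Nat.cast_sub (by omega)]
      push_cast
      linarith
    exact_mod_cast this
  have hc : ‖c‖ = 1 := by
    have h₁ : ‖U (f i)‖ ^ 2 = ‖f i‖ ^ 2 := by
      simp only [← he.sum_norm_inner_sq, hnorm]
    rw [hexp, norm_smul, hf.norm_eq_one hi, hf.norm_eq_one (by omega), mul_one, one_pow] at h₁
    exact (pow_eq_one_iff_of_nonneg (norm_nonneg c) two_ne_zero).1 h₁
  have h := hnorm k (f i)
  rw [hexp, inner_smul_right, norm_mul, hc, one_mul] at h
  rwa [norm_inner_symm, norm_inner_symm (f i)]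

/-- The diagonal of the spectral projection `𝟙_{(0,∞)}(J₁)` in the weight basis of `J₃` is `1 / 2`,
up to an error of total mass at most `1 / 2`. -/
theorem abs_card_sub_two_mul_sum_le (hJ : IsSpinTriple J₁ J₂ J₃) (he : IsLadderBasis J₁ J₂ J₃ e)
    (hf : IsLadderBasis J₂ J₃ J₁ f) (hPs : P.IsSymmetric)
    (hP : ∀ i, P (f i) = if i < n / 2 then f i else 0) {A : Finset ℕ} (hA : A ⊆ Finset.range n) :
    |(A.card : ℝ) - 2 * ∑ k ∈ A, ‖P (e k)‖ ^ 2| ≤ 1 := by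
  have key : ∀ k ∈ A, 0 ≤ 1 - 2 * ‖P (e k)‖ ^ 2 ∧
      1 - 2 * ‖P (e k)‖ ^ 2 ≤ ‖⟪f (n / 2), e k⟫_ℂ‖ ^ 2 := by
    intro k hk
    have hk := Finset.mem_range.1 (hA hk)
    have h₁ : ‖P (e k)‖ ^ 2 = ∑ i ∈ Finset.range n,
        if i < n / 2 then ‖⟪f i, e k⟫_ℂ‖ ^ 2 else 0 := hf.norm_apply_sq hPs hP (e k)
    have h₂ : ‖P (e k)‖ ^ 2 = ∑ i ∈ Finset.range n,
        if n - 1 - i < n / 2 then ‖⟪f i, e k⟫_ℂ‖ ^ 2 else 0 := by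
      rw [h₁, ← Finset.sum_range_reflect]
      refine Finset.sum_congr rfl fun i hi => ?_
      rw [norm_inner_reflect hJ he hf (Finset.mem_range.1 hi)]
    have h₃ : 1 = ∑ i ∈ Finset.range n, ‖⟪f i, e k⟫_ℂ‖ ^ 2 := by
      rw [hf.sum_norm_inner_sq, he.norm_eq_one hk, one_pow]
    -- Only an index `i` with neither `i` nor its mirror image below `n / 2` survives: the middle
    -- one for odd `n`, none for even `n`.
    have h₄ : 1 - 2 * ‖P (e k)‖ ^ 2 = ∑ i ∈ Finset.range n,
        if ¬ (i < n / 2 ∨ n - 1 - i < n / 2) then ‖⟪f i, e k⟫_ℂ‖ ^ 2 else 0 := by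
      rw [two_mul, ← sub_sub]
      nth_rw 1 [h₁]
      rw [h₂, h₃, ← Finset.sum_sub_distrib, ← Finset.sum_sub_distrib]
      refine Finset.sum_congr rfl fun i hi => ?_
      have := Finset.mem_range.1 hi
      by_cases a : i < n / 2
      · simp [a, show ¬ n - 1 - i < n / 2 by omega]
      · by_cases b : n - 1 - i < n / 2 <;>
          simp only [a, b, or_true, or_false, not_true_eq_false, not_false_eq_true, if_true,
            if_false] <;> ring
    rw [h₄]
    constructor
    · exact Finset.sum_nonneg fun i _ => by split_ifs <;> positivity
    · rw [← Finset.sum_filter]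
      refine (Finset.sum_le_sum_of_subset_of_nonneg (t := {n / 2}) (fun i hi => ?_)
        fun _ _ _ => sq_nonneg _).trans_eq (Finset.sum_singleton _ _)
      simp only [Finset.mem_filter, Finset.mem_range] at hi
      rw [Finset.mem_singleton]
      omega
  have hsum : (A.card : ℝ) - 2 * ∑ k ∈ A, ‖P (e k)‖ ^ 2 = ∑ k ∈ A, (1 - 2 * ‖P (e k)‖ ^ 2) := by
    rw [Finset.sum_sub_distrib, Finset.mul_sum]
    simp
  rw [hsum, abs_of_nonneg (Finset.sum_nonneg fun k hk => (key k hk).1)]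
  refine (Finset.sum_le_sum fun k hk => (key k hk).2).trans ((Finset.sum_le_sum_of_subset_of_nonneg
    hA fun _ _ _ => sq_nonneg _).trans ?_)
  simp_rw [norm_inner_symm (f (n / 2))]
  rw [he.sum_norm_inner_sq]
  rcases lt_or_ge (n / 2) n with h | h
  · rw [hf.norm_eq_one h, one_pow]
  · rw [hf.eq_zero _ h]
    simp

/-- The spectral projection `𝟙_{(0,∞)}(J₁)` has logarithmic mass across the boundary of an interval
of weights of `J₃`. -/
theorem sum_norm_inner_sq_boundary_le (hJ : IsSpinTriple J₁ J₂ J₃) (he : IsLadderBasis J₁ J₂ J₃ e)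
    (hf : IsLadderBasis J₂ J₃ J₁ f) (hP : ∀ i, P (f i) = if i < n / 2 then f i else 0)
    {p a : ℕ} {δ : ℝ} (hδ : 0 < δ) (hδp : δ * n ≤ p) (hp : 0 < p) (hpn : 4 * p ≤ n)
    (ha : a = 0 ∨ 2 * p ≤ a) (han : a ≤ n / 2) :
    ∑ k ∈ Finset.Ico a (n / 2), ∑ l ∈ Finset.range n \ Finset.Ico a (n / 2),
      ‖⟪e k, P (e l)⟫_ℂ‖ ^ 2 ≤
        (1 / (4 * δ ^ 2) + (8 * Real.exp (4 / δ ^ 2)) ^ 2) * (1 + Real.log n) := by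
  obtain ⟨m, hm⟩ : ∃ m, n / 2 = m + 1 := ⟨n / 2 - 1, by omega⟩
  have hmn : m + 1 < n := by omega
  have hn' : (0 : ℝ) < n := by exact_mod_cast (by omega : 0 < n)
  have hP' : ∀ i, P (f i) = if i ≤ m then f i else 0 := fun i => by
    rw [hP, hm]
    simp only [Nat.lt_succ_iff]
  have hbulk : ∀ i, i = m ∨ i = m + 1 → ∀ k, p ≤ k → k + p ≤ n →
      n * ‖⟪e k, f i⟫_ℂ‖ ^ 2 ≤ 8 * Real.exp (4 / δ ^ 2) := by
    intro i hi k h₁ h₂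
    have h := he.norm_inner_sq_le hJ.isSymmetric_one (hf.weight i) ?_ hp hpn hδ hδp h₁ h₂
    · rwa [hf.norm_eq_one (by omega), one_pow, mul_one] at h
    -- The two weights at the cutoff are `±1/2` for even `n`, and `1`, `0` for odd `n`.
    · have : n = 2 * m + 2 ∨ n = 2 * m + 3 := by omega
      rw [abs_le]
      rcases this with h | h <;> rcases hi with rfl | rfl <;> rw [h] <;> push_cast <;>
        constructor <;> linarith
  -- The final `omega` places near pairs in the bulk: `n / 2 ≥ 2 p` handles the upper end, and the
  -- lower end is either at least `2 p` or is `0`, with nothing beyond it.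
  refine (sum_sq_boundary_le (by omega) hp han (by omega)
    (g := fun k l => ‖⟪e k, P (e l)⟫_ℂ‖) (U := fun k => ‖⟪e k, f m⟫_ℂ‖)
    (W := fun k => ‖⟪e k, f (m + 1)⟫_ℂ‖) (fun _ _ => norm_nonneg _)
    (he.abs_sub_mul_norm_inner_le hf hJ.isSymmetric_three hmn hP') ?_ ?_
    (hbulk m (Or.inl rfl)) (hbulk (m + 1) (Or.inr rfl)) (by omega)).trans ?_
  · rw [he.sum_norm_inner_sq, hf.norm_eq_one (by omega), one_pow]
  · rw [he.sum_norm_inner_sq, hf.norm_eq_one (by omega), one_pow]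
  · have hlog : 0 ≤ Real.log n := Real.log_natCast_nonneg n
    have h₁ : (n : ℝ) ^ 2 / (4 * p ^ 2) ≤ 1 / (4 * δ ^ 2) := by
      have hp' : (0 : ℝ) < p := by exact_mod_cast hp
      rw [div_le_div_iff₀ (by positivity) (by positivity)]
      have := pow_le_pow_left₀ (by positivity) hδp 2
      nlinarith
    have h₂ : (0 : ℝ) ≤ 1 / (4 * δ ^ 2) := by positivity
    nlinarith [mul_nonneg h₂ hlog]

end IsLadderBasis

/-! ### Spectrum of the compression -/

open Classical in
lemma eigenvalueCount_eq_card {V : Type*} [NormedAddCommGroup V] [InnerProductSpace ℂ V]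
    [FiniteDimensional ℂ V] {T : Module.End ℂ V} (hT : T.IsSymmetric) {d : ℕ}
    (hd : Module.finrank ℂ V = d) (s t : ℝ) :
    eigenvalueCount T s t =
      (Finset.univ.filter fun i => hT.eigenvalues hd i ∈ Set.Icc s t).card := by
  rw [eigenvalueCount, hT.roots_charpoly_eq_eigenvalues hd, Multiset.countP_map]
  rw [← Finset.filter_val, Finset.card_val]
  congr 1
  ext i
  simp only [Finset.mem_filter, Finset.mem_univ, true_and]
  constructor
  · rintro ⟨x, hx, h⟩
    have h : hT.eigenvalues hd i = x := Complex.ofReal_injective h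
    rwa [h]
  · exact fun h => ⟨_, h, rfl⟩

section Compression

variable {n : ℕ} {P Q : Module.End ℂ (EuclideanSpace ℂ (Fin n))}

lemma coe_compression_apply (x : LinearMap.range P) :
    (compression P Q x : EuclideanSpace ℂ (Fin n)) = P (Q (P x)) := rfl

lemma apply_coe_range (hPi : ∀ x, P (P x) = P x) (x : LinearMap.range P) :
    P (x : EuclideanSpace ℂ (Fin n)) = x := by
  obtain ⟨_, y, rfl⟩ := x
  exact hPi y

lemma isSymmetric_compression (hP : P.IsSymmetric) (hQ : Q.IsSymmetric) :
    LinearMap.IsSymmetric (𝕜 := ℂ) (E := LinearMap.range P) (compression P Q) := by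
  intro x y
  rw [Submodule.coe_inner, Submodule.coe_inner, coe_compression_apply, coe_compression_apply, hP,
    hQ, hP]

lemma norm_le_of_idem (hQ : Q.IsSymmetric) (hQi : ∀ x, Q (Q x) = Q x) (x) : ‖Q x‖ ≤ ‖x‖ := by
  have h₁ : ⟪Q x, Q x⟫_ℂ = ⟪x, Q x⟫_ℂ := by rw [hQ, hQi]
  have h₂ : ‖Q x‖ * ‖Q x‖ ≤ ‖x‖ * ‖Q x‖ := by
    rw [← inner_self_eq_norm_mul_norm (𝕜 := ℂ), h₁]
    exact re_inner_le_norm x (Q x)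
  rcases (norm_nonneg (Q x)).eq_or_lt with h | h
  · rw [← h]; exact norm_nonneg x
  · exact le_of_mul_le_mul_right h₂ h

lemma sum_norm_inner_coe_sq (hP : P.IsSymmetric) (hPi : ∀ x, P (P x) = P x) {ι : Type*} [Fintype ι]
    (b : OrthonormalBasis ι ℂ (LinearMap.range P)) (y) :
    ∑ i, ‖⟪(b i : EuclideanSpace ℂ (Fin n)), y⟫_ℂ‖ ^ 2 = ‖P y‖ ^ 2 := by
  have h := b.sum_sq_norm_inner_right ⟨P y, LinearMap.mem_range_self P y⟩
  rw [Submodule.coe_norm] at h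
  rw [← h]
  refine Finset.sum_congr rfl fun i _ => ?_
  rw [Submodule.coe_inner, ← hP, apply_coe_range hPi]

/-- Hilbert–Schmidt norm of an operator on the range of a projection, computed in two ways. -/
lemma sum_norm_apply_coe_sq {J₁ J₂ J₃ : Module.End ℂ (EuclideanSpace ℂ (Fin n))}
    {e : ℕ → EuclideanSpace ℂ (Fin n)} (he : IsLadderBasis J₁ J₂ J₃ e) (hP : P.IsSymmetric)
    (hPi : ∀ x, P (P x) = P x) (hQ : Q.IsSymmetric) {p : ℕ → Prop}
    [DecidablePred p] (hPe : ∀ k, P (e k) = if p k then e k else 0) {ι : Type*} [Fintype ι]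
    (b : OrthonormalBasis ι ℂ (LinearMap.range P)) :
    ∑ i, ‖Q (b i)‖ ^ 2 = ∑ k ∈ Finset.range n, if p k then ‖Q (e k)‖ ^ 2 else 0 := by
  calc ∑ i, ‖Q (b i)‖ ^ 2
      = ∑ i, ∑ k ∈ Finset.range n, ‖⟪(b i : EuclideanSpace ℂ (Fin n)), Q (e k)⟫_ℂ‖ ^ 2 := by
        refine Finset.sum_congr rfl fun i _ => ?_
        rw [← he.sum_norm_inner_sq]
        refine Finset.sum_congr rfl fun k _ => ?_
        rw [norm_inner_symm, hQ]
    _ = ∑ k ∈ Finset.range n, ‖P (Q (e k))‖ ^ 2 := by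
        rw [Finset.sum_comm]
        exact Finset.sum_congr rfl fun k _ => sum_norm_inner_coe_sq hP hPi b _
    _ = ∑ k ∈ Finset.range n, ∑ l ∈ Finset.range n,
          if p l then ‖⟪e k, Q (e l)⟫_ℂ‖ ^ 2 else 0 := by
        refine Finset.sum_congr rfl fun k _ => ?_
        rw [he.norm_apply_sq hP hPe]
        refine Finset.sum_congr rfl fun l _ => ?_
        rw [← hQ, norm_inner_symm]
    _ = _ := by
        rw [Finset.sum_comm]
        refine Finset.sum_congr rfl fun l _ => ?_
        split_ifs
        · rw [he.sum_norm_inner_sq]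
        · simp

open Classical in
/-- The spectrum of the compression of a projection `Q` to the span of the weight vectors of index
in `A`. -/
theorem exists_eigenvalues_compression {J₁ J₂ J₃ : Module.End ℂ (EuclideanSpace ℂ (Fin n))}
    {e : ℕ → EuclideanSpace ℂ (Fin n)} (he : IsLadderBasis J₁ J₂ J₃ e) (hP : P.IsSymmetric)
    (hPi : ∀ x, P (P x) = P x) (hQ : Q.IsSymmetric) (hQi : ∀ x, Q (Q x) = Q x) {A : Finset ℕ}
    (hA : A ⊆ Finset.range n) (hPe : ∀ k, P (e k) = if k ∈ A then e k else 0) :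
    ∃ ev : Fin A.card → ℝ,
      (∀ s t, eigenvalueCount (compression P Q) s t =
        (Finset.univ.filter fun i => ev i ∈ Set.Icc s t).card) ∧
      (∀ i, ev i ∈ Set.Icc 0 1) ∧ ∑ i, ev i = ∑ k ∈ A, ‖Q (e k)‖ ^ 2 ∧
      ∑ i, ev i * (1 - ev i) =
        ∑ k ∈ A, ∑ l ∈ Finset.range n \ A, ‖⟪e k, Q (e l)⟫_ℂ‖ ^ 2 := by
  have hsub : ∀ g : ℕ → ℝ, (∑ k ∈ Finset.range n, if k ∈ A then g k else 0) = ∑ k ∈ A, g k := by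
    intro g
    rw [← Finset.sum_filter, Finset.filter_mem_eq_inter, Finset.inter_eq_right.2 hA]
  have hd : Module.finrank ℂ (LinearMap.range P) = A.card := by
    -- The Hilbert–Schmidt identity for the identity operator computes the rank of `P`.
    have h := sum_norm_apply_coe_sq (Q := 1) he hP hPi (fun _ _ => rfl) hPe
      (stdOrthonormalBasis ℂ (LinearMap.range P))
    rw [hsub] at h
    have h₁ : ∀ k ∈ A, ‖(1 : Module.End ℂ (EuclideanSpace ℂ (Fin n))) (e k)‖ ^ 2 = 1 :=
      fun k hk => by
        rw [Module.End.one_apply, he.norm_eq_one (Finset.mem_range.1 (hA hk)), one_pow]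
    rw [Finset.sum_congr rfl h₁] at h
    simp only [Module.End.one_apply, Submodule.norm_coe, OrthonormalBasis.norm_eq_one] at h
    simp only [one_pow, Finset.sum_const, Finset.card_univ, Fintype.card_fin, nsmul_eq_mul,
      mul_one] at h
    exact_mod_cast h
  have hT := isSymmetric_compression hP hQ
  set b := hT.eigenvectorBasis hd
  set ev := hT.eigenvalues hd
  have hev : ∀ i, P (Q (b i)) = (ev i : ℂ) • (b i : EuclideanSpace ℂ (Fin n)) := fun i => by
    have := congrArg Subtype.val (hT.apply_eigenvectorBasis hd i)
    rw [coe_compression_apply, apply_coe_range hPi] at this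
    exact this
  have hb1 : ∀ i, ‖(b i : EuclideanSpace ℂ (Fin n))‖ = 1 := fun i => by
    rw [Submodule.norm_coe, b.norm_eq_one]
  have hev₁ : ∀ i, ev i = ‖Q (b i)‖ ^ 2 := fun i => by
    have h₁ : ⟪(b i : EuclideanSpace ℂ (Fin n)), P (Q (b i))⟫_ℂ = ⟪Q (b i), Q (b i)⟫_ℂ := by
      rw [← hP, apply_coe_range hPi, hQ, hQi]
    rw [hev, inner_smul_right, inner_self_eq_norm_sq_to_K, inner_self_eq_norm_sq_to_K, hb1] at h₁
    refine Complex.ofReal_injective ?_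
    rw [Complex.ofReal_pow]
    simpa using h₁
  have hev₂ : ∀ i, ev i ^ 2 = ‖P (Q (b i))‖ ^ 2 := fun i => by
    rw [hev, norm_smul, hb1, mul_one, Complex.norm_real, Real.norm_eq_abs, sq_abs]
  have hs₁ : ∑ i, ev i = ∑ k ∈ A, ‖Q (e k)‖ ^ 2 := by
    simp only [hev₁]
    rw [sum_norm_apply_coe_sq he hP hPi hQ hPe b, hsub]
  have hs₂ : ∑ i, ev i ^ 2 = ∑ k ∈ A, ∑ l ∈ A, ‖⟪e k, Q (e l)⟫_ℂ‖ ^ 2 := by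
    calc ∑ i, ev i ^ 2
        = ∑ i, ∑ k ∈ A, ‖⟪(b i : EuclideanSpace ℂ (Fin n)), Q (e k)⟫_ℂ‖ ^ 2 := by
          refine Finset.sum_congr rfl fun i _ => ?_
          rw [hev₂, he.norm_apply_sq hP hPe, hsub]
          refine Finset.sum_congr rfl fun k _ => ?_
          rw [← hQ, norm_inner_symm]
      _ = ∑ k ∈ A, ‖P (Q (e k))‖ ^ 2 := by
          rw [Finset.sum_comm]
          exact Finset.sum_congr rfl fun k _ => sum_norm_inner_coe_sq hP hPi b _
      _ = _ := by
          refine Finset.sum_congr rfl fun k _ => ?_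
          rw [he.norm_apply_sq hP hPe, hsub]
          refine Finset.sum_congr rfl fun l _ => ?_
          rw [← hQ, norm_inner_symm]
  refine ⟨ev, eigenvalueCount_eq_card hT hd, fun i => ⟨?_, ?_⟩, hs₁, ?_⟩
  · rw [hev₁]; positivity
  · rw [hev₁, ← one_pow 2, ← hb1 i]
    exact pow_le_pow_left₀ (norm_nonneg _) (norm_le_of_idem hQ hQi _) 2
  · have h₁ : ∑ i, ev i * (1 - ev i) = ∑ i, ev i - ∑ i, ev i ^ 2 := by
      rw [← Finset.sum_sub_distrib]
      exact Finset.sum_congr rfl fun i _ => by ring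
    -- By Parseval, removing the entries with `l ∈ A` from `‖Q (e k)‖²` leaves those with `l ∉ A`.
    rw [h₁, hs₁, hs₂, ← Finset.sum_sub_distrib]
    refine Finset.sum_congr rfl fun k _ => ?_
    rw [← he.sum_norm_inner_sq (Q (e k)), ← Finset.sum_sdiff hA]
    have : ∀ l, ‖⟪e l, Q (e k)⟫_ℂ‖ ^ 2 = ‖⟪e k, Q (e l)⟫_ℂ‖ ^ 2 := fun l => by
      rw [← hQ, norm_inner_symm]
    simp only [this, add_sub_cancel_right]

end Compression

/-! ### Indices of the weights in `(0, x)` -/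

lemma Finset.eq_Ico_of_upward_closed {B : Finset ℕ} {h : ℕ} (hB : ∀ k ∈ B, k < h)
    (hup : ∀ k ∈ B, ∀ l, k ≤ l → l < h → l ∈ B) : B = Finset.Ico (h - B.card) h := by
  rcases B.eq_empty_or_nonempty with rfl | hne
  · simp
  · have hBI : B = Finset.Ico (B.min' hne) h := by
      ext l
      rw [Finset.mem_Ico]
      exact ⟨fun hl => ⟨B.min'_le l hl, hB l hl⟩, fun hl => hup _ (B.min'_mem hne) l hl.1 hl.2⟩
    have hcard : B.card = h - B.min' hne := by
      conv_lhs => rw [hBI]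
      exact Nat.card_Ico _ _
    rw [hcard, Nat.sub_sub_self (hB _ (B.min'_mem hne)).le]
    exact hBI

/-- The weights in `(0, x)`, when there are `d` of them, are those of index in
`[n / 2 - d, n / 2)`. -/
lemma weight_mem_Ioo_iff {n d : ℕ} {x : ℝ}
    (hx : (Set.Ioo 0 x ∩ spinSpectrum n).ncard = d) {k : ℕ} (hk : k < n) :
    ((n : ℝ) - 1) / 2 - k ∈ Set.Ioo 0 x ↔ k ∈ Finset.Ico (n / 2 - d) (n / 2) := by
  classical
  set w : ℕ → ℝ := fun k => ((n : ℝ) - 1) / 2 - k with hw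
  have hpos : ∀ k, 0 < w k → k < n / 2 := by
    intro k hk
    have : (2 * k + 1 : ℝ) < n := by simp only [hw] at hk; linarith
    have : 2 * k + 1 < n := by exact_mod_cast this
    omega
  set B := (Finset.range n).filter fun k => w k ∈ Set.Ioo 0 x
  have himage : Set.Ioo 0 x ∩ spinSpectrum n = w '' (B : Set ℕ) := by
    ext y
    simp only [spinSpectrum, Set.mem_inter_iff, Set.mem_range, Set.mem_image, Finset.mem_coe,
      Finset.mem_filter, Finset.mem_range, B]
    constructor
    · rintro ⟨hy, i, rfl⟩
      exact ⟨i, ⟨i.2, hy⟩, rfl⟩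
    · rintro ⟨i, ⟨hi, hy⟩, rfl⟩
      exact ⟨hy, ⟨i, hi⟩, rfl⟩
  have hcard : B.card = d := by
    rw [himage, Set.ncard_image_of_injective _ fun i j hij => by simpa [hw] using hij,
      Set.ncard_coe_finset] at hx
    exact hx
  -- Weights decrease with the index, so below `n / 2` the condition of being less than `x` is
  -- upward closed.
  have hB : B = Finset.Ico (n / 2 - d) (n / 2) := by
    rw [← hcard]
    refine Finset.eq_Ico_of_upward_closed (fun k hk => ?_) fun k hk l hkl hl => ?_
    · exact hpos k (Finset.mem_filter.1 hk).2.1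
    · have h₁ := (Finset.mem_filter.1 hk).2
      refine Finset.mem_filter.2 ⟨Finset.mem_range.2 (by omega), ?_, ?_⟩
      · have : (2 * l + 2 : ℝ) ≤ n := by exact_mod_cast (by omega : 2 * l + 2 ≤ n)
        simp only [hw]
        linarith
      · refine lt_of_le_of_lt ?_ h₁.2
        simp only [hw]
        gcongr
  rw [← hB, Finset.mem_filter, Finset.mem_range]
  exact ⟨fun h => ⟨hk, h⟩, fun h => h.2⟩

/-! ### Counting eigenvalues by `∑ λ` and `∑ λ (1 - λ)` -/

section Counting

open Classical

variable {d : ℕ} {ev : Fin d → ℝ} {t : ℝ}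

/-- On `[t, 1 - t]` one has `λ (1 - λ) ≥ t (1 - t) ≥ t / 2`. -/
lemma card_middle_le (hev : ∀ i, ev i ∈ Set.Icc 0 1) (ht₀ : 0 < t) (ht₁ : t < 1 / 2) :
    ((Finset.univ.filter fun i => ev i ∈ Set.Icc t (1 - t)).card : ℝ) ≤
      2 / t * ∑ i, ev i * (1 - ev i) := by
  rw [Finset.natCast_card_filter, Finset.mul_sum]
  refine Finset.sum_le_sum fun i _ => ?_
  obtain ⟨h₀, h₁⟩ := hev i
  have h₂ : 0 ≤ ev i * (1 - ev i) := mul_nonneg h₀ (by linarith)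
  split_ifs with h
  · rw [div_mul_eq_mul_div, le_div_iff₀ ht₀]
    nlinarith [mul_nonneg (sub_nonneg.2 h.1) (sub_nonneg.2 h.2)]
  · positivity

/-- Termwise, the indicator of `[1 - t, 1]` differs from `λ` by `1 - λ` or by `λ`; the other factor
of `λ (1 - λ)` is then at least `t`. -/
lemma abs_card_top_sub_le (hev : ∀ i, ev i ∈ Set.Icc 0 1) (ht₀ : 0 < t) (ht₁ : t < 1 / 2) :
    |((Finset.univ.filter fun i => ev i ∈ Set.Icc (1 - t) 1).card : ℝ) - ∑ i, ev i| ≤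
      1 / t * ∑ i, ev i * (1 - ev i) := by
  rw [Finset.natCast_card_filter, Finset.mul_sum, ← Finset.sum_sub_distrib]
  refine (Finset.abs_sum_le_sum_abs _ _).trans (Finset.sum_le_sum fun i _ => ?_)
  obtain ⟨h₀, h₁⟩ := hev i
  rw [div_mul_eq_mul_div, one_mul, le_div_iff₀ ht₀]
  split_ifs with h
  · rw [abs_of_nonneg (by linarith)]
    have := h.1
    nlinarith
  · have : ev i < 1 - t := by
      by_contra h'
      exact h ⟨not_lt.1 h', h₁⟩
    rw [zero_sub, abs_neg, abs_of_nonneg h₀]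
    nlinarith

/-- The substitution `λ ↦ 1 - λ` reduces this to the top of the spectrum. -/
lemma abs_card_bottom_sub_le (hev : ∀ i, ev i ∈ Set.Icc 0 1) (ht₀ : 0 < t) (ht₁ : t < 1 / 2) :
    |((Finset.univ.filter fun i => ev i ∈ Set.Icc 0 t).card : ℝ) - ((d : ℝ) - ∑ i, ev i)| ≤
      1 / t * ∑ i, ev i * (1 - ev i) := by
  have h := abs_card_top_sub_le (ev := fun i => 1 - ev i)
    (fun i => ⟨by linarith [(hev i).2], by linarith [(hev i).1]⟩) ht₀ ht₁
  have h₁ : ∀ i, (1 - ev i ∈ Set.Icc (1 - t) 1) = (ev i ∈ Set.Icc 0 t) := fun i => by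
    simp only [Set.mem_Icc, eq_iff_iff]
    constructor <;> rintro ⟨a, b⟩ <;> constructor <;> linarith
  have h₂ : ∑ i, (1 - ev i) = (d : ℝ) - ∑ i, ev i := by
    rw [Finset.sum_sub_distrib]
    simp
  have h₃ : ∑ i, (1 - ev i) * (1 - (1 - ev i)) = ∑ i, ev i * (1 - ev i) :=
    Finset.sum_congr rfl fun i _ => by ring
  simp only [h₁, h₂, h₃] at h
  exact h

end Counting

/-! ### Assembly and passage to the limit -/

/-- Quantitative form of the eigenvalue asymptotics for one spin triple. -/
theorem eigenvalueCount_compression_estimates {n p d : ℕ} {δ x t : ℝ} (hδ : 0 < δ)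
    (hδp : δ * n ≤ p) (hp : 0 < p) (hpn : 4 * p ≤ n) (hd : n / 2 ≤ d ∨ 2 * p ≤ n / 2 - d)
    (hdn : d ≤ n / 2) {J₁ J₂ J₃ : Module.End ℂ (EuclideanSpace ℂ (Fin n))}
    (hJ : IsSpinTriple J₁ J₂ J₃) (hx : (Set.Ioo 0 x ∩ spinSpectrum n).ncard = d)
    (ht₀ : 0 < t) (ht₁ : t < 1 / 2) {K : ℝ}
    (hK : K = (1 / (4 * δ ^ 2) + (8 * Real.exp (4 / δ ^ 2)) ^ 2) * (1 + Real.log n)) :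
    |(eigenvalueCount (compression (spectralProjection J₃ (Set.Ioo 0 x))
        (spectralProjection J₁ (Set.Ioi 0))) 0 t : ℝ) - d / 2| ≤ 1 / 2 + 1 / t * K ∧
    |(eigenvalueCount (compression (spectralProjection J₃ (Set.Ioo 0 x))
        (spectralProjection J₁ (Set.Ioi 0))) (1 - t) 1 : ℝ) - d / 2| ≤ 1 / 2 + 1 / t * K ∧
    (eigenvalueCount (compression (spectralProjection J₃ (Set.Ioo 0 x))
        (spectralProjection J₁ (Set.Ioi 0))) t (1 - t) : ℝ) ≤ 2 / t * K := by
  classical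
  obtain ⟨e, he⟩ := hJ.exists_isLadderBasis (by omega)
  obtain ⟨f, hf⟩ := hJ.rotate.exists_isLadderBasis (by omega)
  set P := spectralProjection J₃ (Set.Ioo 0 x)
  set Q := spectralProjection J₁ (Set.Ioi 0)
  set A := Finset.Ico (n / 2 - d) (n / 2) with hAdef
  have hA : A ⊆ Finset.range n := fun k hk => by
    rw [hAdef, Finset.mem_Ico] at hk
    rw [Finset.mem_range]
    omega
  have hAcard : A.card = d := by rw [hAdef, Nat.card_Ico]; omega
  have hP : ∀ k, P (e k) = if k ∈ A then e k else 0 := fun k => by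
    rcases lt_or_ge k n with hk | hk
    · rw [he.spectralProjection_apply hJ.isSymmetric_three]
      simp only [weight_mem_Ioo_iff hx hk, hAdef]
    · simp [he.eq_zero k hk]
  have hQ : ∀ i, Q (f i) = if i < n / 2 then f i else 0 := fun i => by
    rw [hf.spectralProjection_apply hJ.isSymmetric_one]
    have : ((n : ℝ) - 1) / 2 - i ∈ Set.Ioi 0 ↔ i < n / 2 := by
      rw [Set.mem_Ioi]
      have h₁ : i < n / 2 ↔ 2 * i + 1 < n := by omega
      have h₂ : 2 * i + 1 < n ↔ (2 * i + 1 : ℝ) < n := by norm_cast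
      rw [h₁, h₂]
      constructor <;> intro h <;> linarith
    simp only [this]
  obtain ⟨ev, hcount, hev, hsum, hsum₂⟩ := exists_eigenvalues_compression he
    isSymmetric_spectralProjection spectralProjection_idem isSymmetric_spectralProjection
    (Q := Q) spectralProjection_idem hA hP
  have hD : ∑ i, ev i * (1 - ev i) ≤ K := by
    rw [hsum₂, hK]
    exact he.sum_norm_inner_sq_boundary_le hJ hf hQ hδ hδp hp hpn (by omega) (by omega)
  have htr := he.abs_card_sub_two_mul_sum_le hJ hf isSymmetric_spectralProjection hQ hA
  rw [← hsum] at htr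
  have hbot := abs_card_bottom_sub_le hev ht₀ ht₁
  rw [← hcount] at hbot
  have htop := abs_card_top_sub_le hev ht₀ ht₁
  rw [← hcount] at htop
  have hmid := card_middle_le hev ht₀ ht₁
  rw [← hcount] at hmid
  have h₁ := mul_le_mul_of_nonneg_left hD (by positivity : 0 ≤ 1 / t)
  have h₂ := mul_le_mul_of_nonneg_left hD (by positivity : 0 ≤ 2 / t)
  have hAcard' : (A.card : ℝ) = d := by rw [hAcard]
  rw [abs_le] at htr hbot htop
  refine ⟨?_, ?_, hmid.trans h₂⟩
  · rw [abs_le]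
    constructor <;> linarith
  · rw [abs_le]
    constructor <;> linarith

lemma tendsto_of_abs_sub_le_log {α K : ℝ} (hα : 0 < α) {N : ℕ → ℝ}
    (hN : ∀ᶠ n : ℕ in atTop, |N n - α * n / 2| ≤ K * (1 + Real.log n)) :
    Tendsto (fun n : ℕ => 1 / (α * (n : ℝ)) * N n) atTop (𝓝 (1 / 2)) := by
  have hlog : Tendsto (fun n : ℕ => K / α * ((1 + Real.log n) / n)) atTop (𝓝 0) := by
    have h₁ : Tendsto (fun n : ℕ => Real.log n / n) atTop (𝓝 0) :=
      (Real.isLittleO_log_id_atTop.tendsto_div_nhds_zero).comp tendsto_natCast_atTop_atTop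
    have h₂ : Tendsto (fun n : ℕ => 1 / (n : ℝ)) atTop (𝓝 0) := tendsto_one_div_atTop_nhds_zero_nat
    have h₃ := (h₂.add h₁).const_mul (K / α)
    simp only [add_zero, mul_zero, ← add_div] at h₃
    exact h₃
  rw [tendsto_iff_dist_tendsto_zero]
  refine squeeze_zero' (Eventually.of_forall fun _ => dist_nonneg) ?_ hlog
  filter_upwards [hN, eventually_gt_atTop 0] with n hn hpos
  have hn' : (0 : ℝ) < n := by exact_mod_cast hpos
  have h₁ : 1 / (α * (n : ℝ)) * N n - 1 / 2 = (N n - α * n / 2) / (α * n) := by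
    field_simp
  rw [Real.dist_eq, h₁, abs_div, abs_of_pos (mul_pos hα hn'), div_mul_div_comm]
  gcongr

theorem mainTheorem3 (α : ℝ) (hα₀ : 0 < α) (hα₁ : α ≤ 1 / 2)
    (J₁ J₂ J₃ : ∀ n : ℕ, Module.End ℂ (EuclideanSpace ℂ (Fin n)))
    (hJ : ∀ n : ℕ, 0 < n → IsSpinTriple (J₁ n) (J₂ n) (J₃ n))
    (a : ℕ → ℝ)
    (ha : ∀ n : ℕ, 0 < n → (Set.Ioo 0 (a n) ∩ spinSpectrum n).ncard = ⌊α * (n : ℝ)⌋₊)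
    (N : ℕ → ℝ → ℝ → ℕ)
    (hN : ∀ n s t, N n s t = eigenvalueCount
      (compression (spectralProjection (J₃ n) (Set.Ioo 0 (a n)))
        (spectralProjection (J₁ n) (Set.Ioi 0))) s t)
    (t : ℝ) (ht₀ : 0 < t) (ht₁ : t < 1 / 2) :
    Tendsto (fun n : ℕ => 1 / (α * (n : ℝ)) * (N n 0 t : ℝ)) atTop (𝓝 (1 / 2)) ∧
    Tendsto (fun n : ℕ => 1 / (α * (n : ℝ)) * (N n (1 - t) 1 : ℝ)) atTop (𝓝 (1 / 2)) ∧
    (fun n : ℕ => (N n t (1 - t) : ℝ)) =O[atTop] (fun n : ℕ => Real.log (n : ℝ)) := by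
  -- For `α = 1/2` the index interval reaches `0`. Otherwise its lower end is about `(1/2 - α) n = 4
  -- δ n`, leaving room for the margin `2 p` with `p ≈ δ n`.
  obtain ⟨δ, hδ, hδ₁, hδα⟩ : ∃ δ : ℝ, 0 < δ ∧ δ ≤ 1 / 8 ∧ (α = 1 / 2 ∨ 4 * δ = 1 / 2 - α) := by
    rcases hα₁.eq_or_lt with h | h
    · exact ⟨1 / 8, by norm_num, le_rfl, Or.inl h⟩
    · exact ⟨(1 / 2 - α) / 4, by linarith, by linarith, Or.inr (by ring)⟩
  set K₀ : ℝ := 1 / (4 * δ ^ 2) + (8 * Real.exp (4 / δ ^ 2)) ^ 2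
  have hK₀ : 0 ≤ K₀ := by positivity
  have main : ∀ᶠ n : ℕ in atTop,
      |(N n 0 t : ℝ) - α * n / 2| ≤ (1 + 1 / t * K₀) * (1 + Real.log n) ∧
      |(N n (1 - t) 1 : ℝ) - α * n / 2| ≤ (1 + 1 / t * K₀) * (1 + Real.log n) ∧
      (N n t (1 - t) : ℝ) ≤ 2 / t * K₀ * (1 + Real.log n) := by
    -- `δ n ≥ 3` absorbs the rounding in `p`, `d` and `n / 2`.
    have hlarge := tendsto_natCast_atTop_atTop.eventually_ge_atTop (3 / δ)
    filter_upwards [hlarge, eventually_ge_atTop 8] with n hn hn₈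
    rw [div_le_iff₀ hδ] at hn
    have hn₈' : (8 : ℝ) ≤ n := by exact_mod_cast hn₈
    have hfl := Nat.floor_le (by positivity : 0 ≤ α * (n : ℝ))
    have hfl' := Nat.lt_floor_add_one (α * (n : ℝ))
    have hp₁ := Nat.le_ceil (δ * n)
    have hp₂ := Nat.ceil_lt_add_one (by positivity : 0 ≤ δ * (n : ℝ))
    have hp₃ : 0 < ⌈δ * (n : ℝ)⌉₊ := Nat.ceil_pos.2 (by positivity)
    set d := ⌊α * (n : ℝ)⌋₊
    set p := ⌈δ * (n : ℝ)⌉₊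
    have hpn : 4 * p ≤ n := by
      have : (4 * p : ℝ) ≤ n := by nlinarith
      exact_mod_cast this
    have hdn : d ≤ n / 2 := by
      have : (2 * d : ℝ) ≤ n := by nlinarith
      have : 2 * d ≤ n := by exact_mod_cast this
      omega
    have hd : n / 2 ≤ d ∨ 2 * p ≤ n / 2 - d := by
      rcases hδα with h | h
      · left
        have : (n : ℝ) < 2 * d + 2 := by rw [h] at hfl'; linarith
        have : n < 2 * d + 2 := by exact_mod_cast this
        omega
      · right
        have : (4 * p + 2 * d + 1 : ℝ) ≤ n := by nlinarith
        have : 4 * p + 2 * d + 1 ≤ n := by exact_mod_cast this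
        omega
    obtain ⟨h₁, h₂, h₃⟩ := eigenvalueCount_compression_estimates hδ hp₁ hp₃ hpn hd hdn
      (hJ n (by omega)) (ha n (by omega)) ht₀ ht₁ rfl
    have hlog : 0 ≤ Real.log n := Real.log_natCast_nonneg n
    rw [hN, hN, hN]
    rw [abs_le] at h₁ h₂
    -- Replacing `d / 2` by `α n / 2` costs at most `1 / 2`; with the `1 / 2` from the trace this
    -- gives the summand `1` of the constant.
    refine ⟨?_, ?_, h₃.trans_eq (by ring)⟩
    · rw [abs_le]
      constructor <;> linarith
    · rw [abs_le]
      constructor <;> linarith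
  refine ⟨tendsto_of_abs_sub_le_log hα₀ (main.mono fun n h => h.1),
    tendsto_of_abs_sub_le_log hα₀ (main.mono fun n h => h.2.1), ?_⟩
  -- The factor `2` comes from `1 + log n ≤ 2 log n` once `log n ≥ 1`.
  refine IsBigO.of_bound (2 * (2 / t * K₀)) ?_
  have hlog := (Real.tendsto_log_atTop.comp tendsto_natCast_atTop_atTop).eventually_ge_atTop 1
  filter_upwards [main, hlog] with n h hlog
  simp only [Function.comp_apply] at hlog
  rw [Real.norm_of_nonneg (Nat.cast_nonneg _), Real.norm_of_nonneg (by linarith)]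
  have : 0 ≤ 2 / t * K₀ := by positivity
  nlinarith [h.2.2]
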